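/- **Setting.** Let $m\ge 2$ agents be connected by an undirected connected graph $G$ on $\{1,\dots,m\}$. Agent $i$ holds a differentiable function $f_i:\mathbb R^d\to\mathbb R$ that is $\mu$-strongly convex and $L$-smooth, $\mu>0$, i.e. $\frac{\mu}{2}\|y-x\|^2\le f_i(y)-f_i(x)-\langle\nabla f_i(x),y-x\rangle\le\frac{L}{2}\|y-x\|^2$ for all $x,y$. Let $B\in\mathbb R^{p\times d}$, $B\neq 0$, $\ker B\ne\{0\}$, and let $W\in\mathbb R^{m\times m}$ be symmetric positive semi-definite with $W_{ij}=0$ whenever $i\ne j$ are not adjacent and $\ker W=\mathrm{span}\{\mathbf 1\}$. Put $\mathbf W=W\otimes I_d$, $\mathbf B=I_m\otimes B$, $F(\mathbf x)=\sum_i f_i(x_i)$ for $\mathbf x=(x_1,\dots,x_m)\in\mathbb R^{md}$, and let $\mathbf x^*$ solve $\min F(\mathbf x)$ subject to $\mathbf W\mathbf x=0$, $\mathbf B\mathbf x=0$. For a nonzero symmetric positive semi-definite $M$ let $\chi(M)=\lambda_{\max}(M)/\lambda_{\min}^+(M)$, where $\lambda_{\min}^+$ is the least nonzero eigenvalue.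 One *gradient call* evaluates every $\nabla f_i$ once at the current block of node $i$; one *communication* is a multiplication by $\mathbf W$; multiplications by $\mathbf B$, $\mathbf B^\top$ are counted as one multiplication by $B$, $B^\top$ at each node. **APDG** for $\min_{\mathbf x}\max_{\mathbf y}F(\mathbf x)+\langle\mathbf y,\mathbf A\mathbf x\rangle$, with $\mathbf x^0\in\mathrm{range}\,\mathbf A^\top$, $\mathbf y^0\in\mathrm{range}\,\mathbf A$, parameters $\eta_x,\eta_y,\alpha_x,\beta_x,\beta_y>0$, $\tau_x,\tau_y,\sigma_x,\sigma_y\in(0,1]$, $\theta\in(0,1)$, starts from $\mathbf x_f^0=\mathbf x^0$, $\mathbf y_f^0=\mathbf y^{-1}=\mathbf y^0$ and iterates $$\begin{aligned} \mathbf y_m^k&=\mathbf y^k+\theta(\mathbf y^k-\mathbf y^{k-1}),\quad \mathbf x_g^k=\tau_x\mathbf x^k+(1-\tau_x)\mathbf x_f^k,\quad \mathbf y_g^k=\tau_y\mathbf y^k+(1-\tau_y)\mathbf y_f^k,\\ \mathbf x^{k+1}&=\mathbf x^k+\eta_x\alpha_x(\mathbf x_g^k-\mathbf x^k)-\eta_x\beta_x\mathbf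 A^\top\mathbf A\mathbf x^k-\eta_x(\nabla F(\mathbf x_g^k)+\mathbf A^\top\mathbf y_m^k),\\ \mathbf y^{k+1}&=\mathbf y^k-\eta_y\beta_y\mathbf A(\mathbf A^\top\mathbf y^k+\nabla F(\mathbf x_g^k))+\eta_y\mathbf A\mathbf x^{k+1},\\ \mathbf x_f^{k+1}&=\mathbf x_g^k+\sigma_x(\mathbf x^{k+1}-\mathbf x^k),\quad \mathbf y_f^{k+1}=\mathbf y_g^k+\sigma_y(\mathbf y^{k+1}-\mathbf y^k). \end{aligned}$$ **Chebyshev polynomials.** For $M$ as above with $l=\lambda_{\min}^+(M)$, $u=\lambda_{\max}(M)$, $K=\lfloor\sqrt{\chi(M)}\rfloor$ let $P_M(t)=1-T_K\!\left(\frac{u+l-2t}{u-l}\right)/\,T_K\!\left(\frac{u+l}{u-l}\right)$, and $P_M(t)=t/u$ if $l=u$, where $T_K$ is the Chebyshev polynomial of the first kind. **Theorem.** There are an absolute constant $C>0$ and a rule that computes admissible parameters of APDG from $\mu$, $L$, $\lambda_{\min}^+(\mathbf A^\top\mathbf A)$, $\lambda_{\max}(\mathbf A^\top\mathbf A)$ alone,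 such that for every problem as above the following hold. 1. *(Optimal $\gamma$.)* For $\mathbf A_\gamma=\begin{pmatrix}\mathbf B\\ \gamma\mathbf W\end{pmatrix}$, the minimum of $\chi(\mathbf A_\gamma^\top\mathbf A_\gamma)$ over $\gamma>0$ is attained at $\gamma=\sqrt{\lambda_{\min}^+(B^\top B)}/\lambda_{\min}^+(W)$ and equals $\chi:=\chi(W)^2+\chi(B^\top B)$. Write $\mathbf A$ for $\mathbf A_\gamma$ at this $\gamma$. 2. *(APDG.)* Run APDG with $\mathbf A$ from any admissible $\mathbf x^0,\mathbf y^0$; put $\mathbf p^0=\mathbf A^\top\mathbf y^0$, $\kappa=\max\{\sqrt{\chi}\sqrt{L/\mu},\,\chi\}$ and $$D=C\,\frac L\mu\Big(\|\mathbf x^0-\mathbf x^*\|+\frac{\|\mathbf p^0\|+\|\nabla F(\mathbf x^*)\|}{\mu}\Big).$$ The first $N$ iterations use exactly $N$ gradient calls and at most $CN$ communications. For every $\varepsilon>0$: $\|\mathbf x^N-\mathbf x^*\|\le\varepsilon$ for all $N\ge C\kappa\log(D/\varepsilon)$; $|F(\mathbf x^N)-F(\mathbf x^*)|\le\varepsilon$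 for all $N\ge C\kappa\log(LD^2/\varepsilon)$; $\|\mathbf A\mathbf x^N\|\le\varepsilon$ for all $N\ge C\kappa\log(\sqrt{\lambda_{\max}(\mathbf A^\top\mathbf A)}\,D/\varepsilon)$ (with the convention $\log 0=0$ if $D=0$). So $\varepsilon$-accuracy takes $O\big(\max\{\sqrt{\chi(W)^2+\chi(B^\top B)}\sqrt{L/\mu},\ \chi(W)^2+\chi(B^\top B)\}\log\frac1\varepsilon\big)$ gradient calls and communications, up to the dependence of the logarithm on the problem data and the starting point. 3. *(Chebyshev acceleration.)* The polynomials $P_W$ and $P_{B^\top B}$ have degrees at most $C\sqrt{\chi(W)}$ and $C\sqrt{\chi(B^\top B)}$, and $\chi(P_W(W))\le C$, $\chi(P_{B^\top B}(B^\top B))\le C$. Replace $W$ by $P_W(W)$, $B^\top B$ by $P_{B^\top B}(B^\top B)$, and $\gamma$ by the value that is optimal for these matrices, and run APDG in the variables $\mathbf p=\mathbf A^\top\mathbf y$ (in which it uses $\mathbf A$ only through $\mathbf A^\top\mathbf A$) from any $\mathbf x^0,\mathbf p^0\in\mathrm{range}\,\mathbf A^\top$, evaluating the polynomials by Horner's rule.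 Its iterates $\mathbf x^k$ are those of APDG for the matrix $\begin{pmatrix}I_m\otimes B'\\ \gamma P_W(W)\otimes I_d\end{pmatrix}$, for some $B'$ with $B'^\top B'=P_{B^\top B}(B^\top B)$, from admissible starting points. The first $N$ iterations use exactly $N$ gradient calls, at most $CN\sqrt{\chi(W)}$ communications and at most $CN\sqrt{\chi(B^\top B)}$ multiplications by $B$, $B^\top$ at each node, and the three accuracy estimates of part 2 (with the same $D$ and the original $\mathbf A$) hold with $\kappa=\sqrt{L/\mu}$. So $N=O(\sqrt{L/\mu}\,\log\frac1\varepsilon)$ gradient calls per node, $O(N\sqrt{\chi(W)})$ communications and $O(N\sqrt{\chi(B^\top B)})$ multiplications by $B$, $B^\top$ give $\varepsilon$-accuracy. -/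

import Mathlib

open scoped Matrix Kronecker

noncomputable section

namespace DecOpt

/-! ### Spectral quantities of symmetric positive semi-definite matrices -/

/-- The largest eigenvalue `λ_max(M)`. -/
def lamMax {ι : Type} [Fintype ι] [DecidableEq ι] (M : Matrix ι ι ℝ) : ℝ :=
  sSup (spectrum ℝ M)

/-- The smallest nonzero eigenvalue `λ_min⁺(M)` (of a nonzero positive semi-definite `M`). -/
def lamMinPos {ι : Type} [Fintype ι] [DecidableEq ι] (M : Matrix ι ι ℝ) : ℝ :=
  sInf (spectrum ℝ M \ {0})

/-- The condition number `χ(M) = λ_max(M) / λ_min⁺(M)`. -/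
def condNum {ι : Type} [Fintype ι] [DecidableEq ι] (M : Matrix ι ι ℝ) : ℝ :=
  lamMax M / lamMinPos M

/-! ### The decentralized problem -/

/-- The stacked space `(ℝ^q)^m` with its Euclidean norm; node `i` holds the block `(i, ·)`. -/
abbrev Stack (m q : ℕ) : Type := EuclideanSpace ℝ (Fin m × Fin q)

/-- The space of the multipliers `(u, v)`, `u ∈ (ℝ^q)^m`, `v ∈ (ℝ^d)^m`. -/
abbrev Mult (m q d : ℕ) : Type := EuclideanSpace ℝ ((Fin m × Fin q) ⊕ (Fin m × Fin d))

/-- The block held by node `i`. -/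
def block {m q : ℕ} (x : Stack m q) (i : Fin m) : EuclideanSpace ℝ (Fin q) :=
  WithLp.toLp 2 fun j => x (i, j)

/-- `f` is differentiable, `μ`-strongly convex and `L`-smooth. -/
structure StronglyConvexSmooth {d : ℕ} (μ L : ℝ) (f : EuclideanSpace ℝ (Fin d) → ℝ) : Prop where
  differentiable : Differentiable ℝ f
  lower : ∀ x y, f x + inner ℝ (gradient f x) (y - x) + μ / 2 * ‖y - x‖ ^ 2 ≤ f y
  upper : ∀ x y, f y ≤ f x + inner ℝ (gradient f x) (y - x) + L / 2 * ‖y - x‖ ^ 2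

/-- The assumptions on the matrix that represents the communication network. -/
structure IsMixingMatrix {m : ℕ} (G : SimpleGraph (Fin m)) (W : Matrix (Fin m) (Fin m) ℝ) :
    Prop where
  posSemidef : W.PosSemidef
  compatible : ∀ i j, i ≠ j → ¬ G.Adj i j → W i j = 0
  kernel : ∀ v : Fin m → ℝ, W *ᵥ v = 0 ↔ ∀ i j, v i = v j

/-- The data of `min ∑ i, f i x` subject to `B x = 0`, distributed over a network of `m` agents. -/
structure Problem (m d p : ℕ) where
  /-- the communication graph -/
  G : SimpleGraph (Fin m)
  /-- the mixing matrix -/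
  W : Matrix (Fin m) (Fin m) ℝ
  /-- the affine constraints -/
  B : Matrix (Fin p) (Fin d) ℝ
  /-- the local objectives -/
  f : Fin m → EuclideanSpace ℝ (Fin d) → ℝ
  /-- the strong convexity constant -/
  μ : ℝ
  /-- the smoothness constant -/
  L : ℝ

/-- The standing assumptions. `two_le` and `B_ne_zero` say that `W` and `BᵀB` have a nonzero
eigenvalue, i.e. that the condition numbers `χ(W)` and `χ(BᵀB)` make sense. -/
structure Problem.Valid {m d p : ℕ} (P : Problem m d p) : Prop where
  two_le : 2 ≤ m
  connected : P.G.Connected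
  mixing : IsMixingMatrix P.G P.W
  B_ne_zero : P.B ≠ 0
  ker_B : ∃ x : Fin d → ℝ, x ≠ 0 ∧ P.B *ᵥ x = 0
  mu_pos : 0 < P.μ
  objective : ∀ i, StronglyConvexSmooth P.μ P.L (P.f i)

/-- `𝐖 = W ⊗ I_d`. -/
def bigW {m : ℕ} (d : ℕ) (W : Matrix (Fin m) (Fin m) ℝ) :
    Matrix (Fin m × Fin d) (Fin m × Fin d) ℝ :=
  W ⊗ₖ (1 : Matrix (Fin d) (Fin d) ℝ)

/-- `𝐁 = I_m ⊗ B`. -/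
def bigB {q d : ℕ} (m : ℕ) (B : Matrix (Fin q) (Fin d) ℝ) :
    Matrix (Fin m × Fin q) (Fin m × Fin d) ℝ :=
  (1 : Matrix (Fin m) (Fin m) ℝ) ⊗ₖ B

/-- `𝐀 = [𝐁; γ𝐖]`. -/
def conMat {m q d : ℕ} (B : Matrix (Fin q) (Fin d) ℝ) (W : Matrix (Fin m) (Fin m) ℝ) (γ : ℝ) :
    Matrix ((Fin m × Fin q) ⊕ (Fin m × Fin d)) (Fin m × Fin d) ℝ :=
  Matrix.fromRows (bigB m B) (γ • bigW d W)

/-- `γ = √(λ_min⁺(Q)) / λ_min⁺(W)`, to be used with `Q = BᵀB`. -/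
def gammaOpt {m d : ℕ} (Q : Matrix (Fin d) (Fin d) ℝ) (W : Matrix (Fin m) (Fin m) ℝ) : ℝ :=
  √(lamMinPos Q) / lamMinPos W

/-- `F(𝐱) = ∑ i, f i (x_i)`. -/
def Problem.F {m d p : ℕ} (P : Problem m d p) (x : Stack m d) : ℝ :=
  ∑ i, P.f i (block x i)

/-- `∇F(𝐱) = col(∇f_1(x_1), …, ∇f_m(x_m))`. -/
def Problem.gradF {m d p : ℕ} (P : Problem m d p) (x : Stack m d) : Stack m d :=
  WithLp.toLp 2 fun ij => gradient (P.f ij.1) (block x ij.1) ij.2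

/-- `𝐱` satisfies `𝐖𝐱 = 0` and `𝐁𝐱 = 0`. -/
def Problem.Feasible {m d p : ℕ} (P : Problem m d p) (x : Stack m d) : Prop :=
  (bigW d P.W).toEuclideanLin x = 0 ∧ (bigB m P.B).toEuclideanLin x = 0

/-- `𝐱` solves `min F(𝐱)` subject to `𝐖𝐱 = 0`, `𝐁𝐱 = 0`. -/
def Problem.IsSolution {m d p : ℕ} (P : Problem m d p) (x : Stack m d) : Prop :=
  P.Feasible x ∧ ∀ z, P.Feasible z → P.F x ≤ P.F z

/-- The matrix `𝐀` of the problem at the optimal `γ`. -/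
def Problem.A {m d p : ℕ} (P : Problem m d p) :
    Matrix ((Fin m × Fin p) ⊕ (Fin m × Fin d)) (Fin m × Fin d) ℝ :=
  conMat P.B P.W (gammaOpt (P.Bᵀ * P.B) P.W)

/-! ### APDG for `min_x max_y F(x) + ⟨y, A x⟩` -/

/-- The parameters of APDG. -/
structure APDGParams where
  ηx : ℝ
  ηy : ℝ
  αx : ℝ
  βx : ℝ
  βy : ℝ
  τx : ℝ
  τy : ℝ
  σx : ℝ
  σy : ℝ
  θ : ℝ

/-- The admissible parameters of APDG. -/
def APDGParams.Valid (c : APDGParams) : Prop :=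
  0 < c.ηx ∧ 0 < c.ηy ∧ 0 < c.αx ∧ 0 < c.βx ∧ 0 < c.βy ∧
    c.τx ∈ Set.Ioc (0 : ℝ) 1 ∧ c.τy ∈ Set.Ioc (0 : ℝ) 1 ∧
    c.σx ∈ Set.Ioc (0 : ℝ) 1 ∧ c.σy ∈ Set.Ioc (0 : ℝ) 1 ∧ c.θ ∈ Set.Ioo (0 : ℝ) 1

/-- The variables `x^k, x_f^k, y^k, y^{k-1}, y_f^k`. -/
structure APDGState (E F : Type) where
  x : E
  xf : E
  y : F
  yPrev : F
  yf : F

/-- The initial state. -/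
def APDGState.init {E F : Type} (x₀ : E) (y₀ : F) : APDGState E F := ⟨x₀, x₀, y₀, y₀, y₀⟩

/-- One iteration of APDG. -/
def apdgStep {ι κ : Type} [Fintype ι] [DecidableEq ι] [Fintype κ] [DecidableEq κ]
    (A : Matrix κ ι ℝ) (grad : EuclideanSpace ℝ ι → EuclideanSpace ℝ ι) (c : APDGParams)
    (s : APDGState (EuclideanSpace ℝ ι) (EuclideanSpace ℝ κ)) :
    APDGState (EuclideanSpace ℝ ι) (EuclideanSpace ℝ κ) :=
  let ym := s.y + c.θ • (s.y - s.yPrev)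
  let xg := c.τx • s.x + (1 - c.τx) • s.xf
  let yg := c.τy • s.y + (1 - c.τy) • s.yf
  let x' := s.x + (c.ηx * c.αx) • (xg - s.x)
    - (c.ηx * c.βx) • Aᵀ.toEuclideanLin (A.toEuclideanLin s.x)
    - c.ηx • (grad xg + Aᵀ.toEuclideanLin ym)
  let y' := s.y - (c.ηy * c.βy) • A.toEuclideanLin (Aᵀ.toEuclideanLin s.y + grad xg)
    + c.ηy • A.toEuclideanLin x'
  ⟨x', xg + c.σx • (x' - s.x), y', s.y, yg + c.σy • (y' - s.y)⟩

/-- The state of APDG after `N` iterations. -/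
def apdg {ι κ : Type} [Fintype ι] [DecidableEq ι] [Fintype κ] [DecidableEq κ]
    (A : Matrix κ ι ℝ) (grad : EuclideanSpace ℝ ι → EuclideanSpace ℝ ι) (c : APDGParams)
    (x₀ : EuclideanSpace ℝ ι) (y₀ : EuclideanSpace ℝ κ) :
    ℕ → APDGState (EuclideanSpace ℝ ι) (EuclideanSpace ℝ κ)
  | 0 => APDGState.init x₀ y₀
  | N + 1 => apdgStep A grad c (apdg A grad c x₀ y₀ N)

/-! ### Decentralized programs and their cost -/

/-- A decentralized program. Apart from the oracle calls below it has no access to the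
objectives, to `W` and to `B`. -/
inductive Prog (m d p : ℕ) (α : Type) : Type
  /-- stop and return a value -/
  | ret (a : α) : Prog m d p α
  /-- every node `i` calls its oracle `∇f_i` once, at its own block of `x` -/
  | grad (x : Stack m d) (k : Stack m d → Prog m d p α) : Prog m d p α
  /-- one communication round: multiplication by `𝐖` -/
  | comm (x : Stack m d) (k : Stack m d → Prog m d p α) : Prog m d p α
  /-- every node multiplies its block by `B` once -/
  | mulB (x : Stack m d) (k : Stack m p → Prog m d p α) : Prog m d p α
  /-- every node multiplies its block by `Bᵀ` once -/
  | mulBT (u : Stack m p) (k : Stack m d → Prog m d p α) : Prog m d p α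

namespace Prog

variable {m d p : ℕ}

/-- Sequential composition. -/
def andThen {α β : Type} : Prog m d p α → (α → Prog m d p β) → Prog m d p β
  | ret a, g => g a
  | grad x k, g => grad x fun z => (k z).andThen g
  | comm x k, g => comm x fun z => (k z).andThen g
  | mulB x k, g => mulB x fun z => (k z).andThen g
  | mulBT u k, g => mulBT u fun z => (k z).andThen g

instance : Monad (Prog m d p) where
  pure := ret
  bind := andThen

/-- The value that a program returns when it is run on `P`. -/
def out (P : Problem m d p) {α : Type} : Prog m d p α → α
  | ret a => a
  | grad x k => (k (P.gradF x)).out P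
  | comm x k => (k ((bigW d P.W).toEuclideanLin x)).out P
  | mulB x k => (k ((bigB m P.B).toEuclideanLin x)).out P
  | mulBT u k => (k ((bigB m P.Bᵀ).toEuclideanLin u)).out P

/-- The number of gradient calls at each node during the run on `P`. -/
def gradCalls (P : Problem m d p) {α : Type} : Prog m d p α → ℕ
  | ret _ => 0
  | grad x k => (k (P.gradF x)).gradCalls P + 1
  | comm x k => (k ((bigW d P.W).toEuclideanLin x)).gradCalls P
  | mulB x k => (k ((bigB m P.B).toEuclideanLin x)).gradCalls P
  | mulBT u k => (k ((bigB m P.Bᵀ).toEuclideanLin u)).gradCalls P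

/-- The number of communication rounds during the run on `P`. -/
def commRounds (P : Problem m d p) {α : Type} : Prog m d p α → ℕ
  | ret _ => 0
  | grad x k => (k (P.gradF x)).commRounds P
  | comm x k => (k ((bigW d P.W).toEuclideanLin x)).commRounds P + 1
  | mulB x k => (k ((bigB m P.B).toEuclideanLin x)).commRounds P
  | mulBT u k => (k ((bigB m P.Bᵀ).toEuclideanLin u)).commRounds P

/-- The number of multiplications by `B` and `Bᵀ` at each node during the run on `P`. -/
def multsB (P : Problem m d p) {α : Type} : Prog m d p α → ℕ
  | ret _ => 0
  | grad x k => (k (P.gradF x)).multsB P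
  | comm x k => (k ((bigW d P.W).toEuclideanLin x)).multsB P
  | mulB x k => (k ((bigB m P.B).toEuclideanLin x)).multsB P + 1
  | mulBT u k => (k ((bigB m P.Bᵀ).toEuclideanLin u)).multsB P + 1

/-- `x ↦ ∇F(x)`. -/
def callGrad (x : Stack m d) : Prog m d p (Stack m d) := grad x ret

/-- `x ↦ 𝐖x`. -/
def callW (x : Stack m d) : Prog m d p (Stack m d) := comm x ret

/-- `x ↦ 𝐁x`. -/
def callB (x : Stack m d) : Prog m d p (Stack m p) := mulB x ret

/-- `u ↦ 𝐁ᵀu`. -/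
def callBT (u : Stack m p) : Prog m d p (Stack m d) := mulBT u ret

/-- `x ↦ 𝐀x` for `𝐀 = [𝐁; γ𝐖]`. -/
def callA (γ : ℝ) (x : Stack m d) : Prog m d p (Mult m p d) := do
  let u ← callB x
  let v ← callW x
  return WithLp.toLp 2 (Sum.elim u.ofLp (γ • v.ofLp))

/-- `y ↦ 𝐀ᵀy` for `𝐀 = [𝐁; γ𝐖]`; recall that `W` is symmetric. -/
def callAT (γ : ℝ) (y : Mult m p d) : Prog m d p (Stack m d) := do
  let r ← callBT (WithLp.toLp 2 fun a => y (Sum.inl a))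
  let s ← callW (WithLp.toLp 2 fun a => y (Sum.inr a))
  return r + γ • s

/-- One iteration of APDG for `𝐀 = [𝐁; γ𝐖]`. -/
def apdgStep (γ : ℝ) (c : APDGParams) (s : APDGState (Stack m d) (Mult m p d)) :
    Prog m d p (APDGState (Stack m d) (Mult m p d)) := do
  let ym := s.y + c.θ • (s.y - s.yPrev)
  let xg := c.τx • s.x + (1 - c.τx) • s.xf
  let yg := c.τy • s.y + (1 - c.τy) • s.yf
  let g ← callGrad xg
  let ax ← callA γ s.x
  let atax ← callAT γ ax
  let atym ← callAT γ ym
  let x' := s.x + (c.ηx * c.αx) • (xg - s.x) - (c.ηx * c.βx) • atax - c.ηx • (g + atym)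
  let aty ← callAT γ s.y
  let h ← callA γ (aty + g)
  let ax' ← callA γ x'
  let y' := s.y - (c.ηy * c.βy) • h + c.ηy • ax'
  return ⟨x', xg + c.σx • (x' - s.x), y', s.y, yg + c.σy • (y' - s.y)⟩

/-- `N` iterations of APDG for `𝐀 = [𝐁; γ𝐖]`. -/
def apdg (γ : ℝ) (c : APDGParams) (x₀ : Stack m d) (y₀ : Mult m p d) :
    ℕ → Prog m d p (APDGState (Stack m d) (Mult m p d))
  | 0 => return APDGState.init x₀ y₀
  | N + 1 => do
    let s ← apdg γ c x₀ y₀ N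
    apdgStep γ c s

/-- The first `j` steps of Horner's rule for `q(T) x`, where `op` computes `T`. -/
def hornerAux (op : Stack m d → Prog m d p (Stack m d)) (q : Polynomial ℝ) (x : Stack m d) :
    ℕ → Prog m d p (Stack m d)
  | 0 => return q.coeff q.natDegree • x
  | j + 1 => do
    let a ← hornerAux op q x j
    let b ← op a
    return b + q.coeff (q.natDegree - (j + 1)) • x

/-- `x ↦ q(T) x` with `deg q` calls of the program `op` that computes `T`. -/
def horner (op : Stack m d → Prog m d p (Stack m d)) (q : Polynomial ℝ) (x : Stack m d) :
    Prog m d p (Stack m d) :=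
  hornerAux op q x q.natDegree

/-- `x ↦ 𝐁ᵀ𝐁x`. -/
def callBTB (x : Stack m d) : Prog m d p (Stack m d) := do
  let u ← callB x
  callBT u

/-- `x ↦ qB(𝐁ᵀ𝐁)x + γ² qW(𝐖)² x`. -/
def callGram (qW qB : Polynomial ℝ) (γ : ℝ) (x : Stack m d) : Prog m d p (Stack m d) := do
  let r ← horner callBTB qB x
  let s ← horner callW qW x
  let t ← horner callW qW s
  return r + γ ^ 2 • t

/-- One iteration of APDG in the variables `p = 𝐀ᵀy`, in which it uses `𝐀` only through `𝐀ᵀ𝐀`,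
with `W` replaced by `qW(W)` and `BᵀB` replaced by `qB(BᵀB)`. -/
def accStep (qW qB : Polynomial ℝ) (γ : ℝ) (c : APDGParams)
    (s : APDGState (Stack m d) (Stack m d)) :
    Prog m d p (APDGState (Stack m d) (Stack m d)) := do
  let pm := s.y + c.θ • (s.y - s.yPrev)
  let xg := c.τx • s.x + (1 - c.τx) • s.xf
  let pg := c.τy • s.y + (1 - c.τy) • s.yf
  let g ← callGrad xg
  let atax ← callGram qW qB γ s.x
  let x' := s.x + (c.ηx * c.αx) • (xg - s.x) - (c.ηx * c.βx) • atax - c.ηx • (g + pm)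
  let h ← callGram qW qB γ (s.y + g)
  let atax' ← callGram qW qB γ x'
  let p' := s.y - (c.ηy * c.βy) • h + c.ηy • atax'
  return ⟨x', xg + c.σx • (x' - s.x), p', s.y, pg + c.σy • (p' - s.y)⟩

/-- `N` iterations of the accelerated method. -/
def acc (qW qB : Polynomial ℝ) (γ : ℝ) (c : APDGParams) (x₀ p₀ : Stack m d) :
    ℕ → Prog m d p (APDGState (Stack m d) (Stack m d))
  | 0 => return APDGState.init x₀ p₀
  | N + 1 => do
    let s ← acc qW qB γ c x₀ p₀ N
    accStep qW qB γ c s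

end Prog

/-! ### Chebyshev acceleration -/

/-- The shifted and normalized Chebyshev polynomial
`1 - T_K((u + l - 2 X) / (u - l)) / T_K((u + l) / (u - l))`, which vanishes at `0` and is close
to `1` on `[l, u]`. If `l = u`, it is `X / u`. -/
def chebPoly (l u : ℝ) (K : ℕ) : Polynomial ℝ :=
  if l = u then Polynomial.C u⁻¹ * Polynomial.X
  else 1 - Polynomial.C (((Polynomial.Chebyshev.T ℝ K).eval ((u + l) / (u - l)))⁻¹) *
    (Polynomial.Chebyshev.T ℝ K).comp
      (Polynomial.C ((u + l) / (u - l)) - Polynomial.C (2 / (u - l)) * Polynomial.X)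

/-- The Chebyshev polynomial for `M`, of degree `⌊√χ(M)⌋`. -/
def cheb {ι : Type} [Fintype ι] [DecidableEq ι] (M : Matrix ι ι ℝ) : Polynomial ℝ :=
  chebPoly (lamMinPos M) (lamMax M) ⌊√(condNum M)⌋₊

namespace Problem

variable {m d p : ℕ}

/-- `P_K(W)`. -/
def chebW (P : Problem m d p) : Matrix (Fin m) (Fin m) ℝ :=
  Polynomial.aeval P.W (cheb P.W)

/-- `P_M(BᵀB)`. -/
def chebBTB (P : Problem m d p) : Matrix (Fin d) (Fin d) ℝ :=
  Polynomial.aeval (P.Bᵀ * P.B) (cheb (P.Bᵀ * P.B))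

/-- The optimal `γ` after the replacement of `W` and `BᵀB`. -/
def gammaCheb (P : Problem m d p) : ℝ := gammaOpt P.chebBTB P.chebW

/-- `𝐀ᵀ𝐀` after the replacement: `I ⊗ P_M(BᵀB) + γ² P_K(W)² ⊗ I`. -/
def gramCheb (P : Problem m d p) : Matrix (Fin m × Fin d) (Fin m × Fin d) ℝ :=
  bigB m P.chebBTB + P.gammaCheb ^ 2 • bigW d (P.chebW * P.chebW)

/-- The size of the initial error of a method started at `x₀` and `p₀ = 𝐀ᵀy₀`, with solution
`xs`; note that `-∇F(xs)` is the optimal value of `𝐀ᵀy`. -/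
def initError (P : Problem m d p) (xs x₀ p₀ : Stack m d) : ℝ :=
  ‖x₀ - xs‖ + (‖p₀‖ + ‖P.gradF xs‖) / P.μ

/-- After `C · κ · log(D/ε)` iterations the distance of the iterates `x` to the solution `xs` is at
most `ε`. The same holds for the error of the objective and for the violation of the constraints
if `D` is replaced by `L D²` and by `σ_max(𝐀) D`. -/
def HasComplexity (P : Problem m d p) (C κ D : ℝ) (xs : Stack m d) (x : ℕ → Stack m d) : Prop :=
  ∀ ε : ℝ, 0 < ε → ∀ N : ℕ,
    (C * κ * Real.log (D / ε) ≤ N → ‖x N - xs‖ ≤ ε) ∧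
    (C * κ * Real.log (P.L * D ^ 2 / ε) ≤ N → |P.F (x N) - P.F xs| ≤ ε) ∧
    (C * κ * Real.log (√(lamMax (P.Aᵀ * P.A)) * D / ε) ≤ N → ‖P.A.toEuclideanLin (x N)‖ ≤ ε)

/-- The parameters for a constraint matrix `𝐀` with `𝐀ᵀ𝐀 = M`, given the rule `par` that computes
them from `μ`, `L`, `λ_min⁺(𝐀ᵀ𝐀)` and `λ_max(𝐀ᵀ𝐀)`. -/
def params (P : Problem m d p) (par : ℝ → ℝ → ℝ → ℝ → APDGParams)
    (M : Matrix (Fin m × Fin d) (Fin m × Fin d) ℝ) : APDGParams :=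
  par P.μ P.L (lamMinPos M) (lamMax M)

/-- `N` iterations of APDG for `𝐀 = [𝐁; γ𝐖]` at the optimal `γ`. -/
def directProg (P : Problem m d p) (par : ℝ → ℝ → ℝ → ℝ → APDGParams)
    (x₀ : Stack m d) (y₀ : Mult m p d) (N : ℕ) :
    Prog m d p (APDGState (Stack m d) (Mult m p d)) :=
  Prog.apdg (gammaOpt (P.Bᵀ * P.B) P.W) (P.params par (P.Aᵀ * P.A)) x₀ y₀ N

/-- `N` iterations of APDG with Chebyshev acceleration. -/
def chebProg (P : Problem m d p) (par : ℝ → ℝ → ℝ → ℝ → APDGParams)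
    (x₀ p₀ : Stack m d) (N : ℕ) : Prog m d p (APDGState (Stack m d) (Stack m d)) :=
  Prog.acc (cheb P.W) (cheb (P.Bᵀ * P.B)) P.gammaCheb (P.params par P.gramCheb) x₀ p₀ N

end Problem

end DecOpt

end

open DecOpt

/-! First-order optimality makes `∇F(x*)` orthogonal to `ker A`, so `-∇F(x*) = Aᵀy*` for some `y* ∈
range A` (`Valid.inner_gradF_eq_zero`, `exists_mem_range_of_mem_range_transpose`), and `(x*, y*)` is
a saddle point. Convergence follows from an `energy` made of squared distances to the saddle point,
the Bregman divergence at `x_f`, and a term carrying the momentum of `y`. One step multiplies it by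
at most `θ` (`energy_apdgStep_le`). Strong convexity contracts `x`. The `βy` term contracts `y`,
which never leaves `range A`, where `‖Aᵀy‖² ≥ l‖y‖²`. The averaging that defines `x_g` contracts the
Bregman term, and extrapolation makes the bilinear terms telescope. `apdgRule` meets all the
required inequalities with `1 - θ = 1/(16κ)`, where `κ = max {√χ √(L/μ), χ}`.

The Gram matrix `I ⊗ BᵀB + γ² W² ⊗ I` is a sum of commuting matrices with eigenvalues `β + γ²ω²`
(`spectrum_gram`). Both factors are singular, so its least nonzero eigenvalue is a minimum of two
terms, and the optimal `γ` balances them.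

A Chebyshev polynomial of degree about `√χ` sends the nonzero eigenvalues into `[2/5, 8/5]` and
fixes `0` (`eval_cheb_mem_Icc`, `eval_cheb_zero`). Kernels, hence constraints, are unchanged, while
both condition numbers drop to at most `4` and the combined one to at most `4² + 4 = 20`.
`Valid.hasComplexity_apdg` covers every constraint matrix whose kernel is the feasible subspace, so
it serves both methods. Applying `Aᵀ` to the dual variables turns APDG into an iteration that sees
only `AᵀA` (`Prog.out_acc`). The costs are counted along the monadic structure of the programs. -/

namespace DecOpt

/-! ### Orthogonal diagonalization -/

section Spectral

variable {ι κ : Type} [Fintype ι] [DecidableEq ι] [Fintype κ] [DecidableEq κ]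

/-- `M = U diag(D) Uᵀ` with `U` orthogonal. -/
structure IsDiagonalization (M U : Matrix ι ι ℝ) (D : ι → ℝ) : Prop where
  orth : Uᵀ * U = 1
  eq : M = U * Matrix.diagonal D * Uᵀ

theorem IsDiagonalization.exists_of_isHermitian {M : Matrix ι ι ℝ} (hM : M.IsHermitian) :
    ∃ U D, IsDiagonalization M U D := by
  refine ⟨hM.eigenvectorUnitary, hM.eigenvalues, ?_, ?_⟩
  · have h := Unitary.coe_star_mul_self hM.eigenvectorUnitary
    rwa [Matrix.star_eq_conjTranspose, Matrix.conjTranspose_eq_transpose_of_trivial] at h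
  · have h := hM.spectral_theorem
    rw [Unitary.conjStarAlgAut_apply, Matrix.star_eq_conjTranspose,
      Matrix.conjTranspose_eq_transpose_of_trivial] at h
    exact h

namespace IsDiagonalization

variable {M U : Matrix ι ι ℝ} {D : ι → ℝ}

theorem orth' (h : IsDiagonalization M U D) : U * Uᵀ = 1 :=
  mul_eq_one_comm.mp h.orth

theorem spectrum_eq (h : IsDiagonalization M U D) : spectrum ℝ M = Set.range D := by
  have := spectrum.units_conjugate (R := ℝ) (a := Matrix.diagonal D)
    (u := ⟨U, Uᵀ, h.orth', h.orth⟩)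
  rw [h.eq, ← spectrum_diagonal, ← this]
  rfl

theorem isHermitian (h : IsDiagonalization M U D) : M.IsHermitian := by
  rw [Matrix.IsHermitian, Matrix.conjTranspose_eq_transpose_of_trivial, h.eq]
  simp [Matrix.mul_assoc]

theorem mul {N : Matrix ι ι ℝ} {E : ι → ℝ} (h : IsDiagonalization M U D)
    (h' : IsDiagonalization N U E) : IsDiagonalization (M * N) U (fun i => D i * E i) := by
  refine ⟨h.orth, ?_⟩
  rw [h.eq, h'.eq, ← Matrix.diagonal_mul_diagonal]
  calc _ = U * Matrix.diagonal D * (Uᵀ * U) * (Matrix.diagonal E * Uᵀ) := by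
        simp only [Matrix.mul_assoc]
    _ = _ := by rw [h.orth]; simp only [Matrix.mul_assoc, Matrix.one_mul]

theorem add {N : Matrix ι ι ℝ} {E : ι → ℝ} (h : IsDiagonalization M U D)
    (h' : IsDiagonalization N U E) : IsDiagonalization (M + N) U (fun i => D i + E i) := by
  refine ⟨h.orth, ?_⟩
  rw [h.eq, h'.eq, ← Matrix.diagonal_add, Matrix.mul_add, Matrix.add_mul]

theorem smul (h : IsDiagonalization M U D) (c : ℝ) :
    IsDiagonalization (c • M) U (fun i => c * D i) := by
  refine ⟨h.orth, ?_⟩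
  have : (Matrix.diagonal fun i => c * D i) = c • Matrix.diagonal D := by
    rw [← Matrix.diagonal_smul]; rfl
  rw [h.eq, this, Matrix.mul_smul, Matrix.smul_mul]

theorem one (hU : Uᵀ * U = 1) : IsDiagonalization (1 : Matrix ι ι ℝ) U (fun _ => 1) := by
  refine ⟨hU, ?_⟩
  rw [Matrix.diagonal_one, Matrix.mul_one, mul_eq_one_comm.mp hU]

theorem aeval (h : IsDiagonalization M U D) (q : Polynomial ℝ) :
    IsDiagonalization (Polynomial.aeval M q) U (fun i => q.eval (D i)) := by
  induction q using Polynomial.induction_on' with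
  | add p q hp hq => simpa using hp.add hq
  | monomial n a =>
    have hpow : IsDiagonalization (M ^ n) U (fun i => D i ^ n) := by
      induction n with
      | zero => simpa using one h.orth
      | succ n ih => simpa only [pow_succ] using ih.mul h
    simpa [Polynomial.aeval_monomial, ← Algebra.smul_def] using hpow.smul a

theorem kronecker {N V : Matrix κ κ ℝ} {E : κ → ℝ} (h : IsDiagonalization M U D)
    (h' : IsDiagonalization N V E) :
    IsDiagonalization (M ⊗ₖ N) (U ⊗ₖ V) (fun ij => D ij.1 * E ij.2) := by
  have ht : (U ⊗ₖ V)ᵀ = Uᵀ ⊗ₖ Vᵀ := rfl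
  refine ⟨?_, ?_⟩
  · rw [ht, ← Matrix.mul_kronecker_mul, h.orth, h'.orth, Matrix.one_kronecker_one]
  · rw [ht, h.eq, h'.eq, Matrix.mul_kronecker_mul, Matrix.mul_kronecker_mul,
      Matrix.diagonal_kronecker_diagonal]

theorem mulVec_eq_zero_iff (h : IsDiagonalization M U D) (x : ι → ℝ) :
    M *ᵥ x = 0 ↔ ∀ i, D i = 0 ∨ (Uᵀ *ᵥ x) i = 0 := by
  have key : M *ᵥ x = 0 ↔ Matrix.diagonal D *ᵥ (Uᵀ *ᵥ x) = 0 := by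
    constructor
    · intro hx
      have : Uᵀ *ᵥ (M *ᵥ x) = 0 := by rw [hx, Matrix.mulVec_zero]
      rw [h.eq, Matrix.mul_assoc, Matrix.mulVec_mulVec, ← Matrix.mul_assoc, h.orth,
        Matrix.one_mul, ← Matrix.mulVec_mulVec] at this
      exact this
    · intro hx
      rw [h.eq, ← Matrix.mulVec_mulVec, ← Matrix.mulVec_mulVec, hx, Matrix.mulVec_zero]
  rw [key, funext_iff]
  simp [Matrix.mulVec_diagonal]

theorem dotProduct_mulVec (h : IsDiagonalization M U D) (x : ι → ℝ) :
    x ⬝ᵥ (M *ᵥ x) = ∑ i, D i * (Uᵀ *ᵥ x) i ^ 2 := by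
  have h1 : x ⬝ᵥ (M *ᵥ x) = (Uᵀ *ᵥ x) ⬝ᵥ (Matrix.diagonal D *ᵥ (Uᵀ *ᵥ x)) := by
    rw [h.eq, ← Matrix.mulVec_mulVec, ← Matrix.mulVec_mulVec, Matrix.dotProduct_mulVec,
      Matrix.mulVec_transpose]
  rw [h1, dotProduct]
  refine Finset.sum_congr rfl fun i _ => ?_
  rw [Matrix.mulVec_diagonal]; ring

theorem posSemidef_iff (h : IsDiagonalization M U D) : M.PosSemidef ↔ ∀ i, 0 ≤ D i := by
  constructor
  · intro hM i
    have h1 : D i ∈ spectrum ℝ M := h.spectrum_eq ▸ ⟨i, rfl⟩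
    rw [hM.1.spectrum_real_eq_range_eigenvalues] at h1
    obtain ⟨j, hj⟩ := h1
    exact hj ▸ hM.eigenvalues_nonneg j
  · intro hD
    refine Matrix.PosSemidef.of_dotProduct_mulVec_nonneg h.isHermitian fun x => ?_
    rw [star_trivial, h.dotProduct_mulVec]
    exact Finset.sum_nonneg fun i _ => mul_nonneg (hD i) (sq_nonneg _)

theorem eq_zero_iff (h : IsDiagonalization M U D) : M = 0 ↔ ∀ i, D i = 0 := by
  constructor
  · intro hM i
    have : Matrix.diagonal D = Uᵀ * M * U := by
      rw [h.eq, Matrix.mul_assoc U, ← Matrix.mul_assoc Uᵀ, h.orth, Matrix.one_mul,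
        Matrix.mul_assoc, h.orth, Matrix.mul_one]
    rw [hM, Matrix.mul_zero, Matrix.zero_mul] at this
    simpa using congrFun (congrFun this i) i
  · intro hD
    rw [h.eq, funext hD]
    simp

end IsDiagonalization

/-! ### Extreme eigenvalues -/

variable {M : Matrix ι ι ℝ}

/-- The spectrum is finite and nonempty, so the supremum is attained and is not a default value. -/
theorem isGreatest_lamMax [Nonempty ι] (hM : M.IsHermitian) :
    IsGreatest (spectrum ℝ M) (lamMax M) := by
  obtain ⟨U, D, h⟩ := IsDiagonalization.exists_of_isHermitian hM
  have hne : (spectrum ℝ M).Nonempty := by rw [h.spectrum_eq]; exact Set.range_nonempty D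
  have hfin : (spectrum ℝ M).Finite := by rw [h.spectrum_eq]; exact Set.finite_range D
  exact ⟨hne.csSup_mem hfin, fun t ht => le_csSup hfin.bddAbove ht⟩

theorem isLeast_lamMinPos (hM : M.IsHermitian) (h0 : M ≠ 0) :
    IsLeast (spectrum ℝ M \ {0}) (lamMinPos M) := by
  obtain ⟨U, D, h⟩ := IsDiagonalization.exists_of_isHermitian hM
  have hfin : (spectrum ℝ M \ {0}).Finite := by
    rw [h.spectrum_eq]; exact (Set.finite_range D).sdiff
  have hne : (spectrum ℝ M \ {0}).Nonempty := by
    rw [Ne, h.eq_zero_iff] at h0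
    push Not at h0
    obtain ⟨i, hi⟩ := h0
    exact ⟨D i, h.spectrum_eq ▸ ⟨i, rfl⟩, hi⟩
  exact ⟨hne.csInf_mem hfin, fun t ht => csInf_le hfin.bddBelow ht⟩

theorem nonempty_of_matrix_ne_zero {ι : Type} {M : Matrix ι ι ℝ} (h0 : M ≠ 0) : Nonempty ι := by
  by_contra h
  rw [not_nonempty_iff] at h
  exact h0 (Subsingleton.elim _ _)

theorem spectrum_nonneg (hM : M.PosSemidef) {t : ℝ} (ht : t ∈ spectrum ℝ M) : 0 ≤ t := by
  rw [hM.1.spectrum_real_eq_range_eigenvalues] at ht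
  obtain ⟨i, rfl⟩ := ht
  exact hM.eigenvalues_nonneg i

theorem lamMinPos_pos (hM : M.PosSemidef) (h0 : M ≠ 0) : 0 < lamMinPos M :=
  have h := (isLeast_lamMinPos hM.1 h0).1
  lt_of_le_of_ne (spectrum_nonneg hM h.1) (Ne.symm h.2)

theorem lamMinPos_le_lamMax (hM : M.PosSemidef) (h0 : M ≠ 0) : lamMinPos M ≤ lamMax M :=
  haveI := nonempty_of_matrix_ne_zero h0
  (isGreatest_lamMax hM.1).2 (isLeast_lamMinPos hM.1 h0).1.1

theorem lamMax_pos (hM : M.PosSemidef) (h0 : M ≠ 0) : 0 < lamMax M :=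
  (lamMinPos_pos hM h0).trans_le (lamMinPos_le_lamMax hM h0)

theorem one_le_condNum (hM : M.PosSemidef) (h0 : M ≠ 0) : 1 ≤ condNum M := by
  rw [condNum, one_le_div (lamMinPos_pos hM h0)]
  exact lamMinPos_le_lamMax hM h0

theorem posSemidef_transpose_mul_self {ι κ : Type} [Fintype ι] [Fintype κ] (A : Matrix κ ι ℝ) :
    (Aᵀ * A).PosSemidef := by
  simpa [Matrix.conjTranspose_eq_transpose_of_trivial] using
    Matrix.posSemidef_conjTranspose_mul_self A

/-- The witness is `√D Uᵀ`. It supplies the matrix `B'` that exhibits the accelerated method as an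
instance of APDG; the program never computes it. -/
theorem exists_transpose_mul_self_eq (hM : M.PosSemidef) : ∃ B : Matrix ι ι ℝ, Bᵀ * B = M := by
  obtain ⟨U, D, h⟩ := IsDiagonalization.exists_of_isHermitian hM.1
  have hD := h.posSemidef_iff.mp hM
  refine ⟨Matrix.diagonal (fun i => √(D i)) * Uᵀ, ?_⟩
  rw [Matrix.transpose_mul, Matrix.transpose_transpose, Matrix.diagonal_transpose,
    Matrix.mul_assoc, ← Matrix.mul_assoc (Matrix.diagonal _), Matrix.diagonal_mul_diagonal, h.eq,
    Matrix.mul_assoc]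
  simp only [Real.mul_self_sqrt (hD _)]

theorem dotProduct_mulVec_le_lamMax (hM : M.IsHermitian) (x : ι → ℝ) :
    x ⬝ᵥ (M *ᵥ x) ≤ lamMax M * (x ⬝ᵥ x) := by
  obtain ⟨U, D, h⟩ := IsDiagonalization.exists_of_isHermitian hM
  have h1 := (IsDiagonalization.one h.orth).dotProduct_mulVec x
  rw [Matrix.one_mulVec] at h1
  rw [h.dotProduct_mulVec, h1, Finset.mul_sum]
  refine Finset.sum_le_sum fun i _ => ?_
  have : Nonempty ι := ⟨i⟩
  have := (isGreatest_lamMax hM).2 (h.spectrum_eq ▸ ⟨i, rfl⟩ : D i ∈ spectrum ℝ M)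
  rw [one_mul]
  exact mul_le_mul_of_nonneg_right this (sq_nonneg _)

/-- In an eigenbasis this is `λ_min⁺ t ≤ t²` for each eigenvalue `t`, trivial at `t = 0`. For `M =
AᵀA` it becomes the lower bound on `‖Aᵀy‖` over `range A` that drives the dual contraction. -/
theorem lamMinPos_mul_dotProduct_le (hM : M.PosSemidef) (h0 : M ≠ 0) (x : ι → ℝ) :
    lamMinPos M * (x ⬝ᵥ (M *ᵥ x)) ≤ (M *ᵥ x) ⬝ᵥ (M *ᵥ x) := by
  obtain ⟨U, D, h⟩ := IsDiagonalization.exists_of_isHermitian hM.1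
  have h1 : (M *ᵥ x) ⬝ᵥ (M *ᵥ x) = x ⬝ᵥ ((M * M) *ᵥ x) := by
    have ht : Mᵀ = M := by
      simpa [Matrix.IsHermitian, Matrix.conjTranspose_eq_transpose_of_trivial] using hM.1
    conv_lhs => rw [Matrix.dotProduct_mulVec, ← Matrix.mulVec_transpose, ht,
      Matrix.mulVec_mulVec, dotProduct_comm]
  rw [h1, (h.mul h).dotProduct_mulVec, h.dotProduct_mulVec, Finset.mul_sum]
  refine Finset.sum_le_sum fun i _ => ?_
  have hi : D i ∈ spectrum ℝ M := h.spectrum_eq ▸ ⟨i, rfl⟩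
  rw [← mul_assoc]
  refine mul_le_mul_of_nonneg_right ?_ (sq_nonneg _)
  by_cases hz : D i = 0
  · simp [hz]
  · exact mul_le_mul_of_nonneg_right ((isLeast_lamMinPos hM.1 h0).2 ⟨hi, hz⟩)
      (spectrum_nonneg hM hi)

end Spectral

/-! ### One step of APDG in coordinates centred at the saddle point -/

section Lyapunov

variable {E F : Type} [NormedAddCommGroup E] [InnerProductSpace ℝ E]
  [NormedAddCommGroup F] [InnerProductSpace ℝ F]

theorem norm_sq_add_increment {V : Type} [NormedAddCommGroup V] [InnerProductSpace ℝ V]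
    (v w : V) : ‖w‖ ^ 2 = ‖v‖ ^ 2 + 2 * inner ℝ (w - v) w - ‖w - v‖ ^ 2 := by
  rw [norm_sub_sq_real, inner_sub_left, real_inner_self_eq_norm_sq, real_inner_comm w v]
  ring

theorem two_inner_le_weighted {V : Type} [NormedAddCommGroup V] [InnerProductSpace ℝ V]
    (v w : V) {t : ℝ} (ht : 0 < t) : -2 * inner ℝ v w ≤ t * ‖v‖ ^ 2 + t⁻¹ * ‖w‖ ^ 2 := by
  have h := sq_nonneg ‖t • v + w‖
  rw [norm_add_sq_real, norm_smul, mul_pow, real_inner_smul_left, Real.norm_eq_abs, sq_abs] at h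
  have h2 : 0 ≤ t⁻¹ * (t ^ 2 * ‖v‖ ^ 2 + 2 * (t * inner ℝ v w) + ‖w‖ ^ 2) :=
    mul_nonneg (inv_nonneg.mpr ht.le) h
  have h3 : t⁻¹ * (t ^ 2 * ‖v‖ ^ 2 + 2 * (t * inner ℝ v w) + ‖w‖ ^ 2)
      = t * ‖v‖ ^ 2 + 2 * inner ℝ v w + t⁻¹ * ‖w‖ ^ 2 := by
    field_simp
  linarith

/-- The update, multiplied by `a = ηx⁻¹`, is paired with `x'`. Here `h` is the Bregman divergence,
with gradient `g` at `xg`, and `s = σx⁻¹`. Strong convexity, convexity and smoothness combine so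
that a surplus `-hg` remains, which pays for the gradient error in `dual_step`; the surplus `-a/2
‖x' - x‖²` pays for `coupling_step`. -/
theorem primal_step {A : E →ₗ[ℝ] F} {At : F →ₗ[ℝ] E}
    (hadj : ∀ x y, inner ℝ (A x) y = inner ℝ x (At y))
    {Λ : ℝ} (hA : ∀ x, ‖A x‖ ^ 2 ≤ Λ * ‖x‖ ^ 2)
    {a μ β s c : ℝ} (hμ : 0 ≤ μ) (hβ : 0 ≤ β) (hs : 1 ≤ s)
    (hstep : μ / 2 + β * Λ + c ≤ a / 2)
    {x x' xg xf g : E} {ym : F} {hg hf hf' : ℝ}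
    (hx' : a • (x' - x) = (μ / 2) • (xg - x) - β • At (A x) - (g + At ym))
    (hx : x = xg - (s - 1 / 2) • (xf - xg))
    (h_opt : hg + μ / 2 * ‖xg‖ ^ 2 ≤ inner ℝ g xg)
    (h_f : hg + inner ℝ g (xf - xg) ≤ hf)
    (h_f' : 2 * s * hf' ≤ 2 * s * hg + 2 * inner ℝ g (x' - x) + c * ‖x' - x‖ ^ 2) :
    a * ‖x'‖ ^ 2 + 2 * s * hf' ≤ (a - μ / 2) * ‖x‖ ^ 2 + (2 * s - 1) * hf - hg
      - a / 2 * ‖x' - x‖ ^ 2 - 2 * inner ℝ ym (A x') := by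
  have e1 := congrArg (fun v => inner ℝ v x') hx'
  simp only [inner_sub_left, inner_add_left, real_inner_smul_left] at e1
  have e2 : inner ℝ (At (A x)) x' = inner ℝ (A x) (A x') := by
    rw [real_inner_comm, ← hadj, real_inner_comm]
  have e3 : inner ℝ (At ym) x' = inner ℝ ym (A x') := by
    rw [real_inner_comm, ← hadj, real_inner_comm]
  rw [e2, e3] at e1
  have e4 := norm_sq_add_increment x x'
  rw [inner_sub_left] at e4
  have e5 : 2 * (inner ℝ xg x' - inner ℝ x x') ≤ ‖xg‖ ^ 2 - ‖x‖ ^ 2 + ‖x' - x‖ ^ 2 := by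
    have h1 := norm_sub_sq_real xg x'
    have h2 := norm_sub_sq_real x' x
    rw [real_inner_comm] at h2
    nlinarith [sq_nonneg ‖xg - x'‖]
  -- By polarization the left side is `‖A(x' - x)‖² - ‖Ax‖² - ‖Ax'‖²`. The `βx` term is thus only an
  -- error to be absorbed; the rate gains nothing from it.
  have e6 : -2 * inner ℝ (A x) (A x') ≤ Λ * ‖x' - x‖ ^ 2 := by
    have h1 := hA (x' - x)
    rw [map_sub, norm_sub_sq_real, real_inner_comm] at h1
    nlinarith [sq_nonneg ‖A x‖, sq_nonneg ‖A x'‖]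
  have e7 : inner ℝ g x = inner ℝ g xg - (s - 1 / 2) * inner ℝ g (xf - xg) := by
    conv_lhs => rw [hx]
    rw [inner_sub_right, real_inner_smul_right]
  have e8 : (2 * s - 1) * (hg + inner ℝ g (xf - xg)) ≤ (2 * s - 1) * hf :=
    mul_le_mul_of_nonneg_left h_f (by linarith)
  have e9 : β * (-2 * inner ℝ (A x) (A x')) ≤ β * (Λ * ‖x' - x‖ ^ 2) :=
    mul_le_mul_of_nonneg_left e6 hβ
  have e10 := mul_le_mul_of_nonneg_left e5 hμ
  have e11 : (μ / 2 + β * Λ + c) * ‖x' - x‖ ^ 2 ≤ a / 2 * ‖x' - x‖ ^ 2 :=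
    mul_le_mul_of_nonneg_right hstep (sq_nonneg _)
  have e12 : inner ℝ g (x' - x) = inner ℝ g x' - inner ℝ g x := inner_sub_right _ _ _
  rw [e12] at h_f'
  have e13 : 0 ≤ μ * ‖xg‖ ^ 2 := by positivity
  have e14 := congrArg (fun t => a * t) e4
  linarith

/-- The `β` term is a gradient step on `½‖Aᵀy + g‖²`. It yields `-β‖Aᵀy'‖² ≤ -βl‖y'‖²`, the only
source of contraction in `y`. The price is an error in `‖y' - y‖²`, covered by `hstep`, and one in
`‖g‖²`, covered by `hg`. -/
theorem dual_step {A : E →ₗ[ℝ] F} {At : F →ₗ[ℝ] E}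
    (hadj : ∀ x y, inner ℝ (A x) y = inner ℝ x (At y))
    {Λ l : ℝ} (hAt : ∀ y, ‖At y‖ ^ 2 ≤ Λ * ‖y‖ ^ 2)
    {b β : ℝ} (hβ : 0 ≤ β) (hstep : 4 * β * Λ ≤ b)
    {x' g : E} {y y' : F} {hg : ℝ}
    (hy' : b • (y' - y) = A x' - β • A (At y + g))
    (hl : l * ‖y'‖ ^ 2 ≤ ‖At y'‖ ^ 2) (h_g : 2 * β * ‖g‖ ^ 2 ≤ hg) :
    (b + β * l) * ‖y'‖ ^ 2 + b / 2 * ‖y' - y‖ ^ 2 ≤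
      b * ‖y‖ ^ 2 + 2 * inner ℝ (A x') y' + hg := by
  have e1 := congrArg (fun v => inner ℝ v y') hy'
  simp only [inner_sub_left, real_inner_smul_left] at e1
  rw [hadj (At y + g)] at e1
  have e4 := norm_sq_add_increment y y'
  rw [inner_sub_left] at e4
  -- Polarization again: the difference `Aᵀy' - (Aᵀy + g)` equals `Aᵀ(y' - y) - g`.
  have e6 : -2 * inner ℝ (At y + g) (At y') ≤
      2 * Λ * ‖y' - y‖ ^ 2 + 2 * ‖g‖ ^ 2 - ‖At y'‖ ^ 2 := by
    have h1 := norm_sub_sq_real (At y') (At y + g)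
    have h2 : At y' - (At y + g) = At (y' - y) - g := by rw [map_sub]; abel
    have h3 : ‖At (y' - y) - g‖ ^ 2 ≤ 2 * ‖At (y' - y)‖ ^ 2 + 2 * ‖g‖ ^ 2 := by
      have h5 := norm_sub_sq_real (At (y' - y)) g
      have h6 := norm_add_sq_real (At (y' - y)) g
      nlinarith [sq_nonneg ‖At (y' - y) + g‖]
    have h4 := hAt (y' - y)
    rw [h2, real_inner_comm] at h1
    nlinarith [sq_nonneg ‖At y + g‖]
  have e7 := mul_le_mul_of_nonneg_left e6 hβ
  have e8 := mul_le_mul_of_nonneg_left hl hβ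
  have e9 : 4 * β * Λ * ‖y' - y‖ ^ 2 ≤ b * ‖y' - y‖ ^ 2 :=
    mul_le_mul_of_nonneg_right hstep (sq_nonneg _)
  have e14 := congrArg (fun t => b * t) e4
  linarith

/-- Extrapolation leaves `2⟨Ax', y' - y⟩ - 2θ⟨Ax', y - yp⟩`. Replacing `x'` by `x` in the second
product makes the two terms consecutive copies of the cross term of the energy; the replacement
error `A(x' - x)` is split by Young's inequality. -/
theorem coupling_step {A : E →ₗ[ℝ] F} {Λ : ℝ} (hA : ∀ x, ‖A x‖ ^ 2 ≤ Λ * ‖x‖ ^ 2)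
    {a b θ : ℝ} (ha : 0 ≤ a) (hb : 0 < b) (hab : 4 * Λ ≤ a * b) (hθ : 0 ≤ θ) (hθ1 : θ ≤ 1)
    (x x' : E) (y y' yp : F) :
    2 * inner ℝ (A x') y' - 2 * inner ℝ (y + θ • (y - yp)) (A x') ≤
      2 * inner ℝ (A x') (y' - y) - 2 * θ * inner ℝ (A x) (y - yp)
        + a / 2 * ‖x' - x‖ ^ 2 + θ * (b / 2) * ‖y - yp‖ ^ 2 := by
  -- The weight `2/b` leaves `b/2` on `‖y - yp‖²`, the coefficient in the energy.
  have h1 := two_inner_le_weighted (A (x' - x)) (y - yp) (t := 2 / b) (by positivity)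
  have h2 : 2 / b * ‖A (x' - x)‖ ^ 2 ≤ a / 2 * ‖x' - x‖ ^ 2 := by
    calc 2 / b * ‖A (x' - x)‖ ^ 2 ≤ 2 / b * (Λ * ‖x' - x‖ ^ 2) :=
          mul_le_mul_of_nonneg_left (hA _) (by positivity)
      _ = 4 * Λ / (2 * b) * ‖x' - x‖ ^ 2 := by field_simp; ring
      _ ≤ a * b / (2 * b) * ‖x' - x‖ ^ 2 := by gcongr
      _ = a / 2 * ‖x' - x‖ ^ 2 := by field_simp
  rw [inv_div] at h1
  have h3 := mul_le_mul_of_nonneg_left (h1.trans (add_le_add_left h2 _)) hθ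
  have h4 : θ * (a / 2 * ‖x' - x‖ ^ 2) ≤ 1 * (a / 2 * ‖x' - x‖ ^ 2) :=
    mul_le_mul_of_nonneg_right hθ1 (by positivity)
  rw [map_sub, inner_sub_left] at h3
  rw [inner_add_left, real_inner_smul_left, real_inner_comm (A x') y,
    real_inner_comm (A x') (y - yp), inner_sub_right (A x') y' y]
  linarith

/-- The same Young estimate shows that the indefinite cross term costs at most half of the primal
distance, so the energy controls `‖x - x*‖²`. -/
theorem weighted_energy_lower {A : E →ₗ[ℝ] F} {Λ : ℝ} (hA : ∀ x, ‖A x‖ ^ 2 ≤ Λ * ‖x‖ ^ 2)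
    {a b : ℝ} (hb : 0 < b) (hab : 4 * Λ ≤ a * b) (x : E) (y : F) :
    a / 2 * ‖x‖ ^ 2 ≤ a * ‖x‖ ^ 2 + b / 2 * ‖y‖ ^ 2 - 2 * inner ℝ (A x) y := by
  have h1 := two_inner_le_weighted (A x) (-y) (t := 2 / b) (by positivity)
  rw [inner_neg_right, norm_neg, inv_div] at h1
  have h2 : 2 / b * ‖A x‖ ^ 2 ≤ a / 2 * ‖x‖ ^ 2 := by
    calc 2 / b * ‖A x‖ ^ 2 ≤ 2 / b * (Λ * ‖x‖ ^ 2) :=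
          mul_le_mul_of_nonneg_left (hA _) (by positivity)
      _ = 4 * Λ / (2 * b) * ‖x‖ ^ 2 := by field_simp; ring
      _ ≤ a * b / (2 * b) * ‖x‖ ^ 2 := by gcongr
      _ = a / 2 * ‖x‖ ^ 2 := by field_simp
  linarith

end Lyapunov

/-! ### Linear convergence of APDG -/

/-- The quadratic bounds that express `μ`-strong convexity and `L`-smoothness of `f`, for a
function `g` in the role of the gradient. -/
structure QuadraticBounds {E : Type} [NormedAddCommGroup E] [InnerProductSpace ℝ E]
    (μ L : ℝ) (f : E → ℝ) (g : E → E) : Prop where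
  lower : ∀ x y, f x + inner ℝ (g x) (y - x) + μ / 2 * ‖y - x‖ ^ 2 ≤ f y
  upper : ∀ x y, f y ≤ f x + inner ℝ (g x) (y - x) + L / 2 * ‖y - x‖ ^ 2

/-! ### Bregman divergences of strongly convex smooth functions -/

section Bregman

variable {E : Type} [NormedAddCommGroup E] [InnerProductSpace ℝ E]

/-- The Bregman divergence of `f` at `z` with respect to `x`. -/
noncomputable def bregman (f : E → ℝ) (g : E → E) (x z : E) : ℝ :=
  f z - f x - inner ℝ (g x) (z - x)

variable {μ L : ℝ} {f : E → ℝ} {g : E → E}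

theorem QuadraticBounds.bregman_nonneg (h : QuadraticBounds μ L f g) (hμ : 0 ≤ μ) (x z : E) :
    0 ≤ bregman f g x z := by
  have h1 := h.lower x z
  have h2 : 0 ≤ μ / 2 * ‖z - x‖ ^ 2 := by positivity
  rw [bregman]
  linarith

theorem QuadraticBounds.bregman_le (h : QuadraticBounds μ L f g) (x z : E) :
    bregman f g x z ≤ L / 2 * ‖z - x‖ ^ 2 := by
  have h1 := h.upper x z
  rw [bregman]
  linarith

/-- The Bregman divergence satisfies the same quadratic bounds as the function. -/
theorem QuadraticBounds.bregman (h : QuadraticBounds μ L f g) (x : E) :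
    QuadraticBounds μ L (bregman f g x) (fun z => g z - g x) := by
  constructor
  all_goals
    intro z w
    have h1 := h.lower z w
    have h2 := h.upper z w
    have h3 : inner ℝ (g x) (w - z) = inner ℝ (g x) (w - x) - inner ℝ (g x) (z - x) := by
      rw [← inner_sub_right]; congr 1; abel
    simp only [DecOpt.bregman, inner_sub_left]
    linarith

/-- A gradient step of length `1/L` from `z` lowers the Bregman divergence by at least `‖g z - g
x‖²/(2L)`, and the result is still nonnegative. -/
theorem QuadraticBounds.norm_grad_sq_le (h : QuadraticBounds μ L f g) (hμ : 0 ≤ μ) (hL : 0 < L)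
    (x z : E) : ‖g z - g x‖ ^ 2 ≤ 2 * L * DecOpt.bregman f g x z := by
  have h1 := (h.bregman x).upper z (z - L⁻¹ • (g z - g x))
  have h2 := h.bregman_nonneg hμ x (z - L⁻¹ • (g z - g x))
  rw [sub_sub_cancel_left, inner_neg_right, real_inner_smul_right, norm_neg, norm_smul,
    real_inner_self_eq_norm_sq, mul_pow, Real.norm_eq_abs, sq_abs] at h1
  have h3 : L / 2 * (L⁻¹ ^ 2 * ‖g z - g x‖ ^ 2) = L⁻¹ / 2 * ‖g z - g x‖ ^ 2 := by
    field_simp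
  have h4 : L⁻¹ / 2 * ‖g z - g x‖ ^ 2 ≤ DecOpt.bregman f g x z := by linarith
  calc ‖g z - g x‖ ^ 2 = 2 * L * (L⁻¹ / 2 * ‖g z - g x‖ ^ 2) := by field_simp
    _ ≤ _ := mul_le_mul_of_nonneg_left h4 (by positivity)

end Bregman

/-- Relations between the parameters of APDG that make its energy contract by the factor `θ`,
for a constraint matrix `A` whose Gram matrix has its nonzero eigenvalues in `[l, Λ]`. -/
structure APDGParams.Contractive (c : APDGParams) (μ L l Λ : ℝ) : Prop where
  ηx_pos : 0 < c.ηx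
  ηy_pos : 0 < c.ηy
  αx_eq : c.αx = μ / 2
  βx_nonneg : 0 ≤ c.βx
  βy_nonneg : 0 ≤ c.βy
  σx_pos : 0 < c.σx
  σx_le : c.σx ≤ 1
  τx_mul : c.τx * (c.σx⁻¹ + 1 / 2) = 1
  θ_nonneg : 0 ≤ c.θ
  θ_le : c.θ ≤ 1
  primal : μ / 2 + c.βx * Λ + L * c.σx ≤ c.ηx⁻¹ / 2
  dual : 4 * c.βy * Λ ≤ c.ηy⁻¹
  grad : 4 * c.βy * L ≤ 1
  coupling : 4 * Λ ≤ c.ηx⁻¹ * c.ηy⁻¹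
  rate_x : c.ηx⁻¹ - μ / 2 ≤ c.θ * c.ηx⁻¹
  rate_f : 2 * c.σx⁻¹ - 1 ≤ c.θ * (2 * c.σx⁻¹)
  rate_y : c.ηy⁻¹ ≤ c.θ * (c.ηy⁻¹ + c.βy * l)

/-! ### Norm bounds from the eigenvalues of the Gram matrix -/

section MatrixBounds

variable {ι κ : Type} [Fintype ι] [DecidableEq ι] [Fintype κ] [DecidableEq κ]

theorem inner_toEuclideanLin_left (A : Matrix κ ι ℝ) (x : EuclideanSpace ℝ ι)
    (y : EuclideanSpace ℝ κ) :
    inner ℝ (A.toEuclideanLin x) y = inner ℝ x (Aᵀ.toEuclideanLin y) := by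
  have h := Matrix.toEuclideanLin_conjTranspose_eq_adjoint A
  rw [Matrix.conjTranspose_eq_transpose_of_trivial] at h
  rw [h, LinearMap.adjoint_inner_right]

theorem norm_sq_eq_dotProduct {ι : Type} [Fintype ι] (x : EuclideanSpace ℝ ι) :
    ‖x‖ ^ 2 = x.ofLp ⬝ᵥ x.ofLp := by
  rw [EuclideanSpace.norm_sq_eq, dotProduct]
  simp [sq]

theorem norm_toEuclideanLin_sq {ι κ : Type} [Fintype ι] [DecidableEq ι] [Fintype κ]
    (A : Matrix κ ι ℝ) (x : EuclideanSpace ℝ ι) :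
    ‖A.toEuclideanLin x‖ ^ 2 = x.ofLp ⬝ᵥ ((Aᵀ * A) *ᵥ x.ofLp) := by
  rw [norm_sq_eq_dotProduct, Matrix.toLpLin_apply, ← Matrix.mulVec_mulVec,
    Matrix.dotProduct_mulVec _ Aᵀ, Matrix.vecMul_transpose]

theorem norm_toEuclideanLin_sq_le {ι κ : Type} [Fintype ι] [DecidableEq ι] [Fintype κ]
    (A : Matrix κ ι ℝ) (x : EuclideanSpace ℝ ι) :
    ‖A.toEuclideanLin x‖ ^ 2 ≤ lamMax (Aᵀ * A) * ‖x‖ ^ 2 := by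
  rw [norm_toEuclideanLin_sq, norm_sq_eq_dotProduct]
  exact dotProduct_mulVec_le_lamMax (posSemidef_transpose_mul_self A).1 _

/-- With `p = Aᵀy`, `‖p‖² = ⟨Ap, y⟩ ≤ √λ_max ‖p‖ ‖y‖`. This avoids comparing the spectra of `AᵀA`
and `AAᵀ`. -/
theorem norm_transpose_toEuclideanLin_sq_le (A : Matrix κ ι ℝ) (h0 : 0 ≤ lamMax (Aᵀ * A))
    (y : EuclideanSpace ℝ κ) :
    ‖Aᵀ.toEuclideanLin y‖ ^ 2 ≤ lamMax (Aᵀ * A) * ‖y‖ ^ 2 := by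
  set p := Aᵀ.toEuclideanLin y
  have h1 : ‖p‖ ^ 2 = inner ℝ (A.toEuclideanLin p) y := by
    rw [inner_toEuclideanLin_left, real_inner_self_eq_norm_sq]
  have h2 : ‖p‖ ^ 2 ≤ ‖A.toEuclideanLin p‖ * ‖y‖ := h1 ▸ real_inner_le_norm _ _
  have h3 := norm_toEuclideanLin_sq_le A p
  by_cases hp : ‖p‖ ^ 2 = 0
  · rw [hp]; positivity
  · have hpos : 0 < ‖p‖ ^ 2 := lt_of_le_of_ne (sq_nonneg _) (Ne.symm hp)
    have h4 : (‖p‖ ^ 2) ^ 2 ≤ (‖A.toEuclideanLin p‖ * ‖y‖) ^ 2 := by gcongr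
    have h5 : ‖A.toEuclideanLin p‖ ^ 2 * ‖y‖ ^ 2 ≤ lamMax (Aᵀ * A) * ‖p‖ ^ 2 * ‖y‖ ^ 2 := by
      gcongr
    refine le_of_mul_le_mul_left ?_ hpos
    nlinarith

theorem toEuclideanLin_mul_apply {ι κ ν : Type} [Fintype ι] [DecidableEq ι] [Fintype ν]
    [DecidableEq ν] (A : Matrix κ ι ℝ)
    (B : Matrix ι ν ℝ) (x : EuclideanSpace ℝ ν) :
    (A * B).toEuclideanLin x = A.toEuclideanLin (B.toEuclideanLin x) := by
  simp [Matrix.toLpLin_apply]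

theorem lamMinPos_mul_norm_sq_le (A : Matrix κ ι ℝ) (h0 : Aᵀ * A ≠ 0)
    {y : EuclideanSpace ℝ κ} (hy : y ∈ A.toEuclideanLin.range) :
    lamMinPos (Aᵀ * A) * ‖y‖ ^ 2 ≤ ‖Aᵀ.toEuclideanLin y‖ ^ 2 := by
  obtain ⟨z, rfl⟩ := hy
  rw [← toEuclideanLin_mul_apply, norm_toEuclideanLin_sq A, norm_sq_eq_dotProduct,
    Matrix.toLpLin_apply]
  exact lamMinPos_mul_dotProduct_le (posSemidef_transpose_mul_self A) h0 _

end MatrixBounds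

/-! ### Contraction of the energy -/

section Convergence

variable {ι κ : Type} [Fintype ι] [DecidableEq ι] [Fintype κ] [DecidableEq κ]
  {A : Matrix κ ι ℝ} {μ L l Λ : ℝ} {f : EuclideanSpace ℝ ι → ℝ}
  {g : EuclideanSpace ℝ ι → EuclideanSpace ℝ ι} {c : APDGParams}
  {xs : EuclideanSpace ℝ ι} {ys : EuclideanSpace ℝ κ}

/-- The energy of a state of APDG relative to the saddle point `(xs, ys)`. -/
noncomputable def energy (A : Matrix κ ι ℝ) (f : EuclideanSpace ℝ ι → ℝ)
    (g : EuclideanSpace ℝ ι → EuclideanSpace ℝ ι) (c : APDGParams) (l : ℝ)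
    (xs : EuclideanSpace ℝ ι) (ys : EuclideanSpace ℝ κ)
    (s : APDGState (EuclideanSpace ℝ ι) (EuclideanSpace ℝ κ)) : ℝ :=
  c.ηx⁻¹ * ‖s.x - xs‖ ^ 2 + 2 * c.σx⁻¹ * bregman f g xs s.xf
    + (c.ηy⁻¹ + c.βy * l) * ‖s.y - ys‖ ^ 2 + c.ηy⁻¹ / 2 * ‖s.y - s.yPrev‖ ^ 2
    - 2 * inner ℝ (A.toEuclideanLin (s.x - xs)) (s.y - s.yPrev)

theorem apdgStep_y_mem_range {s : APDGState (EuclideanSpace ℝ ι) (EuclideanSpace ℝ κ)}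
    (hy : s.y ∈ A.toEuclideanLin.range) : (apdgStep A g c s).y ∈ A.toEuclideanLin.range := by
  refine Submodule.add_mem _ (Submodule.sub_mem _ hy ?_) ?_
  all_goals exact Submodule.smul_mem _ _ ⟨_, rfl⟩

/-- Add `primal_step`, `dual_step` and `coupling_step` in coordinates centred at the saddle point.
The Bregman term at `xg` and the terms in `‖x' - x‖²` cancel, and the three `rate` conditions bound
what remains by `θ` times the old energy. -/
theorem energy_apdgStep_le (hc : c.Contractive μ L l Λ) (hμ : 0 ≤ μ) (hL : 0 < L)
    (hf : QuadraticBounds μ L f g)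
    (hA : ∀ x, ‖A.toEuclideanLin x‖ ^ 2 ≤ Λ * ‖x‖ ^ 2)
    (hAt : ∀ y, ‖Aᵀ.toEuclideanLin y‖ ^ 2 ≤ Λ * ‖y‖ ^ 2)
    (hl : ∀ y ∈ A.toEuclideanLin.range, l * ‖y‖ ^ 2 ≤ ‖Aᵀ.toEuclideanLin y‖ ^ 2)
    (hxs : A.toEuclideanLin xs = 0) (hys : ys ∈ A.toEuclideanLin.range)
    (hsad : Aᵀ.toEuclideanLin ys = -g xs)
    {s : APDGState (EuclideanSpace ℝ ι) (EuclideanSpace ℝ κ)}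
    (hy : s.y ∈ A.toEuclideanLin.range) :
    energy A f g c l xs ys (apdgStep A g c s) ≤ c.θ * energy A f g c l xs ys s := by
  have hy' := apdgStep_y_mem_range (g := g) (c := c) hy
  have hηx := hc.ηx_pos
  have hηy := hc.ηy_pos
  have hσ := hc.σx_pos
  have hσ1 : 1 ≤ c.σx⁻¹ := (one_le_inv₀ hσ).mpr hc.σx_le
  obtain ⟨x, xf, y, yp, yf⟩ := s
  set xg := c.τx • x + (1 - c.τx) • xf with hxg
  set ym := y + c.θ • (y - yp) with hym
  set s' := apdgStep A g c ⟨x, xf, y, yp, yf⟩ with hs'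
  have hx' : s'.x = x + (c.ηx * c.αx) • (xg - x)
    - (c.ηx * c.βx) • Aᵀ.toEuclideanLin (A.toEuclideanLin x)
    - c.ηx • (g xg + Aᵀ.toEuclideanLin ym) := rfl
  have hyy' : s'.y = y - (c.ηy * c.βy) • A.toEuclideanLin (Aᵀ.toEuclideanLin y + g xg)
    + c.ηy • A.toEuclideanLin s'.x := rfl
  have hxf' : s'.xf = xg + c.σx • (s'.x - x) := rfl
  have hyp' : s'.yPrev = y := rfl
  have P := primal_step (inner_toEuclideanLin_left A) hA (a := c.ηx⁻¹) (μ := μ) (β := c.βx)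
    (s := c.σx⁻¹) (c := L * c.σx) hμ hc.βx_nonneg hσ1 hc.primal
    (x := x - xs) (x' := s'.x - xs) (xg := xg - xs) (xf := xf - xs) (g := g xg - g xs)
    (ym := ym - ys) (hg := bregman f g xs xg) (hf := bregman f g xs xf)
    (hf' := bregman f g xs s'.xf) ?_ ?_ ?_ ?_ ?_
  rotate_left
  -- The saddle point equations `A x* = 0` and `Aᵀy* = -g x*` remove every constant created by
  -- centring.
  · rw [hx', ← hc.αx_eq, map_sub, map_sub, map_sub, hxs, hsad, map_zero]
    simp only [mul_smul, smul_sub, smul_add, ← smul_assoc]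
    simp only [smul_eq_mul, inv_mul_cancel₀ hηx.ne', one_mul, one_smul, sub_zero,
      smul_zero]
    module
  -- Solve the average `xg` for `x`; the relation `τx (σx⁻¹ + 1/2) = 1` makes `(1 - τx)/τx` equal to
  -- `σx⁻¹ - 1/2`.
  · have h1 : x = xg - (c.σx⁻¹ - 1 / 2) • (xf - xg) := by
      have h2 : xf - xg = c.τx • (xf - x) := by rw [hxg]; module
      have h3 : (c.σx⁻¹ - 1 / 2) * c.τx = 1 - c.τx := by linarith [hc.τx_mul]
      rw [h2, smul_smul, h3, hxg]
      module
    conv_lhs => rw [h1]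
    module
  · have h := (hf.bregman xs).lower xg xs
    have h0 : bregman f g xs xs = 0 := by simp [bregman]
    have h1 : xs - xg = -(xg - xs) := by abel
    rw [h0, h1, inner_neg_right, norm_neg] at h
    linarith
  · have h := (hf.bregman xs).lower xg xf
    have h1 : xf - xs - (xg - xs) = xf - xg := by abel
    have h2 : 0 ≤ μ / 2 * ‖xf - xg‖ ^ 2 := by positivity
    rw [h1]
    linarith
  · have h := (hf.bregman xs).upper xg s'.xf
    have h1 : s'.xf - xg = c.σx • (s'.x - x) := by rw [hxf']; abel
    have h2 : s'.x - xs - (x - xs) = s'.x - x := by abel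
    rw [h1, real_inner_smul_right, norm_smul, mul_pow, Real.norm_eq_abs, sq_abs] at h
    rw [h2]
    have h3 := mul_le_mul_of_nonneg_left h (a := 2 * c.σx⁻¹) (by positivity)
    refine h3.trans (le_of_eq ?_)
    field_simp
  have Q := dual_step (inner_toEuclideanLin_left A) hAt (l := l) (b := c.ηy⁻¹) (β := c.βy)
    hc.βy_nonneg hc.dual (x' := s'.x - xs) (g := g xg - g xs) (y := y - ys) (y' := s'.y - ys)
    (hg := bregman f g xs xg) ?_ (hl _ (Submodule.sub_mem _ hy' hys)) ?_
  rotate_left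
  · have h1 : Aᵀ.toEuclideanLin (y - ys) + (g xg - g xs) = Aᵀ.toEuclideanLin y + g xg := by
      rw [map_sub, hsad]; abel
    have h2 : s'.y - ys - (y - ys) = s'.y - y := by abel
    rw [h1, h2, map_sub, hxs, sub_zero, hyy']
    generalize A.toEuclideanLin (Aᵀ.toEuclideanLin y + g xg) = v
    generalize A.toEuclideanLin s'.x = w
    have h3 : y - (c.ηy * c.βy) • v + c.ηy • w - y = c.ηy • (w - c.βy • v) := by module
    rw [h3, smul_smul, inv_mul_cancel₀ hηy.ne', one_smul]
  · have h := hf.norm_grad_sq_le hμ hL xs xg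
    have h1 := mul_le_mul_of_nonneg_left h hc.βy_nonneg
    have h2 := mul_le_mul_of_nonneg_right hc.grad (hf.bregman_nonneg hμ xs xg)
    linarith
  have R := coupling_step hA (a := c.ηx⁻¹) (b := c.ηy⁻¹) (by positivity) (by positivity)
    hc.coupling hc.θ_nonneg hc.θ_le (x - xs) (s'.x - xs) (y - ys) (s'.y - ys) (yp - ys)
  have e1 : y - ys + c.θ • (y - ys - (yp - ys)) = ym - ys := by rw [hym]; module
  have e2 : s'.y - ys - (y - ys) = s'.y - y := by abel
  have e3 : y - ys - (yp - ys) = y - yp := by abel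
  have e4 : s'.x - xs - (x - xs) = s'.x - x := by abel
  rw [e1, e2, e3, e4] at R
  rw [e2] at Q
  rw [e4] at P
  have r1 := mul_le_mul_of_nonneg_right hc.rate_x (sq_nonneg ‖x - xs‖)
  have r2 := mul_le_mul_of_nonneg_right hc.rate_f (hf.bregman_nonneg hμ xs xf)
  have r3 := mul_le_mul_of_nonneg_right hc.rate_y (sq_nonneg ‖y - ys‖)
  simp only [energy, hyp']
  linarith

theorem apdg_y_mem_range {x₀ : EuclideanSpace ℝ ι} {y₀ : EuclideanSpace ℝ κ}
    (hy₀ : y₀ ∈ A.toEuclideanLin.range) (N : ℕ) :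
    (apdg A g c x₀ y₀ N).y ∈ A.toEuclideanLin.range := by
  induction N with
  | zero => exact hy₀
  | succ N ih => exact apdgStep_y_mem_range ih

/-- Iterate the contraction. Initially `y⁻¹ = y⁰` kills the momentum terms, and `x_f⁰ = x⁰` lets
smoothness bound the Bregman term by the primal distance. -/
theorem norm_apdg_sub_sq_le (hc : c.Contractive μ L l Λ) (hμ : 0 ≤ μ) (hL : 0 < L)
    (hf : QuadraticBounds μ L f g)
    (hA : ∀ x, ‖A.toEuclideanLin x‖ ^ 2 ≤ Λ * ‖x‖ ^ 2)
    (hAt : ∀ y, ‖Aᵀ.toEuclideanLin y‖ ^ 2 ≤ Λ * ‖y‖ ^ 2)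
    (hl0 : 0 ≤ l)
    (hl : ∀ y ∈ A.toEuclideanLin.range, l * ‖y‖ ^ 2 ≤ ‖Aᵀ.toEuclideanLin y‖ ^ 2)
    (hxs : A.toEuclideanLin xs = 0) (hys : ys ∈ A.toEuclideanLin.range)
    (hsad : Aᵀ.toEuclideanLin ys = -g xs)
    {x₀ : EuclideanSpace ℝ ι} {y₀ : EuclideanSpace ℝ κ}
    (hy₀ : y₀ ∈ A.toEuclideanLin.range) (N : ℕ) :
    c.ηx⁻¹ / 2 * ‖(apdg A g c x₀ y₀ N).x - xs‖ ^ 2 ≤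
      c.θ ^ N * ((c.ηx⁻¹ + L * c.σx⁻¹) * ‖x₀ - xs‖ ^ 2
        + (c.ηy⁻¹ + c.βy * l) * ‖y₀ - ys‖ ^ 2) := by
  have hηx := hc.ηx_pos
  have hηy := hc.ηy_pos
  have hσ := hc.σx_pos
  have hβ := hc.βy_nonneg
  have h1 : energy A f g c l xs ys (apdg A g c x₀ y₀ N) ≤
      c.θ ^ N * energy A f g c l xs ys (apdg A g c x₀ y₀ 0) := by
    induction N with
    | zero => simp
    | succ N ih =>
      calc _ ≤ c.θ * energy A f g c l xs ys (apdg A g c x₀ y₀ N) :=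
            energy_apdgStep_le hc hμ hL hf hA hAt hl hxs hys hsad (apdg_y_mem_range hy₀ N)
        _ ≤ c.θ * _ := mul_le_mul_of_nonneg_left ih hc.θ_nonneg
        _ = _ := by rw [pow_succ]; ring
  have h2 : energy A f g c l xs ys (apdg A g c x₀ y₀ 0) ≤
      (c.ηx⁻¹ + L * c.σx⁻¹) * ‖x₀ - xs‖ ^ 2 + (c.ηy⁻¹ + c.βy * l) * ‖y₀ - ys‖ ^ 2 := by
    have hb := mul_le_mul_of_nonneg_left (hf.bregman_le xs x₀) (a := 2 * c.σx⁻¹) (by positivity)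
    simp only [energy, apdg, APDGState.init, sub_self, norm_zero, inner_zero_right]
    linarith
  have h3 : c.ηx⁻¹ / 2 * ‖(apdg A g c x₀ y₀ N).x - xs‖ ^ 2 ≤
      energy A f g c l xs ys (apdg A g c x₀ y₀ N) := by
    have hw := weighted_energy_lower hA (a := c.ηx⁻¹) (b := c.ηy⁻¹) (by positivity) hc.coupling
      ((apdg A g c x₀ y₀ N).x - xs) ((apdg A g c x₀ y₀ N).y - (apdg A g c x₀ y₀ N).yPrev)
    have hb := hf.bregman_nonneg hμ xs (apdg A g c x₀ y₀ N).xf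
    have t1 : 0 ≤ 2 * c.σx⁻¹ * bregman f g xs (apdg A g c x₀ y₀ N).xf := by positivity
    have t2 : 0 ≤ (c.ηy⁻¹ + c.βy * l) * ‖(apdg A g c x₀ y₀ N).y - ys‖ ^ 2 := by positivity
    simp only [energy]
    linarith
  exact h3.trans (h1.trans (mul_le_mul_of_nonneg_left h2 (pow_nonneg hc.θ_nonneg N)))

end Convergence

/-! ### The choice of the parameters -/

/-- The number `max {√χ √(L/μ), χ}`, `χ = u / l`, that governs the rate of convergence. -/
noncomputable def rateNum (μ L l u : ℝ) : ℝ := max (√(u / l) * √(L / μ)) (u / l)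

/-- The parameters of APDG computed from `μ`, `L` and the extreme nonzero eigenvalues `l`, `u` of
the Gram matrix of the constraints. -/
noncomputable def apdgRule (μ L l u : ℝ) : APDGParams where
  -- Strong convexity contracts `x` by about `μηx` and the dual term contracts `y` by about `l
  -- ηy/L`; both are set to order `1/κ`. The requirement `4u ≤ ηx⁻¹ηy⁻¹` then forces `κ² ≳ χL/μ`.
  ηx := (4 * μ * rateNum μ L l u)⁻¹
  ηy := (2 * l * rateNum μ L l u / L)⁻¹
  αx := μ / 2
  βx := μ * rateNum μ L l u / (2 * u)
  βy := 1 / (4 * L)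
  τx := ((u / l / rateNum μ L l u)⁻¹ + 1 / 2)⁻¹
  -- The sequence `y_f` feeds back into neither `x` nor `y`, so `τy` and `σy` are arbitrary.
  τy := 1
  σx := u / l / rateNum μ L l u
  σy := 1
  θ := 1 - 1 / (16 * rateNum μ L l u)

section Rule

variable {μ L l u : ℝ}

theorem le_rateNum (μ L l u : ℝ) : u / l ≤ rateNum μ L l u := le_max_right _ _

theorem one_le_rateNum (hl : 0 < l) (hu : l ≤ u) : 1 ≤ rateNum μ L l u :=
  ((one_le_div hl).mpr hu).trans (le_rateNum _ _ _ _)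

/-- This half of the maximum pays for smoothness in the primal step and for the coupling; the other
half, `le_rateNum`, gives `σx ≤ 1` and the dual step size. -/
theorem mul_le_rateNum_sq (hμ : 0 < μ) (hL : μ ≤ L) (hl : 0 < l) (hu : l ≤ u) :
    u / l * (L / μ) ≤ rateNum μ L l u ^ 2 := by
  have h1 : 0 ≤ u / l := div_nonneg (hl.le.trans hu) hl.le
  have h2 : 0 ≤ L / μ := div_nonneg (hμ.le.trans hL) hμ.le
  calc u / l * (L / μ) = (√(u / l) * √(L / μ)) ^ 2 := by
        rw [mul_pow, Real.sq_sqrt h1, Real.sq_sqrt h2]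
    _ ≤ _ := by gcongr; exact le_max_left _ _

theorem apdgRule_valid (hμ : 0 < μ) (hL : μ ≤ L) (hl : 0 < l) (hu : l ≤ u) :
    (apdgRule μ L l u).Valid := by
  have hκ : 1 ≤ rateNum μ L l u := one_le_rateNum hl hu
  have hχ := le_rateNum μ L l u
  have hL0 : 0 < L := hμ.trans_le hL
  have hu0 : 0 < u := hl.trans_le hu
  simp only [APDGParams.Valid, apdgRule]
  set κ := rateNum μ L l u
  have hκ0 : 0 < κ := by linarith
  have hσ : u / l / κ ≤ 1 := (div_le_one hκ0).mpr hχ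
  have hσ0 : 0 < u / l / κ := by positivity
  have hσ' : 1 ≤ (u / l / κ)⁻¹ := (one_le_inv₀ hσ0).mpr hσ
  refine ⟨by positivity, by positivity, by positivity, by positivity, by positivity,
    ⟨by positivity, inv_le_one_of_one_le₀ (by linarith)⟩, ⟨one_pos, le_rfl⟩, ⟨hσ0, hσ⟩,
    ⟨one_pos, le_rfl⟩, ?_, ?_⟩
  · rw [sub_pos, div_lt_one (by positivity)]; linarith
  · rw [sub_lt_self_iff]; positivity

theorem apdgRule_contractive (hμ : 0 < μ) (hL : μ ≤ L) (hl : 0 < l) (hu : l ≤ u) :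
    (apdgRule μ L l u).Contractive μ L l u := by
  obtain ⟨h1, h2, -, h4, h5, h6, -, h8, -, h10⟩ := apdgRule_valid hμ hL hl hu
  have hκ : 1 ≤ rateNum μ L l u := one_le_rateNum hl hu
  have hχ := le_rateNum μ L l u
  have hsq := mul_le_rateNum_sq hμ hL hl hu
  have hL0 : 0 < L := hμ.trans_le hL
  have hu0 : 0 < u := hl.trans_le hu
  have hκ0 : 0 < rateNum μ L l u := by linarith
  have hsq' : u * L ≤ rateNum μ L l u ^ 2 * (l * μ) := by
    rwa [div_mul_div_comm, div_le_iff₀ (by positivity)] at hsq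
  rw [div_le_iff₀ hl] at hχ
  refine ⟨h1, h2, rfl, h4.le, h5.le, h8.1, h8.2, ?_, h10.1.le, h10.2.le, ?_, ?_, ?_, ?_, ?_, ?_, ?_⟩
  all_goals simp only [apdgRule, inv_inv]
  all_goals set κ := rateNum μ L l u
  · exact inv_mul_cancel₀ (by positivity)
  · have e1 : μ * κ / (2 * u) * u = μ * κ / 2 := by field_simp
    have e2 : L * (u / l / κ) ≤ μ * κ := by
      rw [div_div, ← mul_div_assoc, div_le_iff₀ (by positivity)]
      nlinarith
    rw [e1]
    nlinarith
  · rw [le_div_iff₀ hL0]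
    have e1 : 4 * (1 / (4 * L)) * u * L = u := by field_simp
    rw [e1]
    nlinarith
  · refine le_of_eq ?_
    field_simp
  · rw [← mul_div_assoc, le_div_iff₀ hL0]
    nlinarith
  · have e1 : (1 - 1 / (16 * κ)) * (4 * μ * κ) = 4 * μ * κ - μ / 4 := by field_simp; ring
    rw [e1]
    linarith
  · have e1 : (1 - 1 / (16 * κ)) * (2 * (u / l / κ)⁻¹) = 2 * (u / l / κ)⁻¹ - l / (8 * u) := by
      field_simp; ring
    have e2 : l / (8 * u) ≤ 1 := by rw [div_le_one (by positivity)]; linarith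
    rw [e1]
    linarith
  · have e1 : (1 - 1 / (16 * κ)) * (2 * l * κ / L + 1 / (4 * L) * l)
        = 2 * l * κ / L + l / (8 * L) * (1 - 1 / (8 * κ)) := by field_simp; ring
    have e2 : 1 / (8 * κ) ≤ 1 := by rw [div_le_one (by positivity)]; linarith
    have e3 : 0 ≤ l / (8 * L) * (1 - 1 / (8 * κ)) := mul_nonneg (by positivity) (by linarith)
    rw [e1]
    linarith

/-- The energy controls squared distances, so the bound is written as a square; this doubles `16` to
`32`. -/
theorem apdgRule_theta_pow_le (hl : 0 < l) (hu : l ≤ u) (N : ℕ) :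
    (apdgRule μ L l u).θ ^ N ≤ Real.exp (-(N / (32 * rateNum μ L l u))) ^ 2 := by
  have hκ : 1 ≤ rateNum μ L l u := one_le_rateNum hl hu
  have h1 : 0 ≤ 1 - 1 / (16 * rateNum μ L l u) := by
    rw [sub_nonneg, div_le_one (by linarith)]; linarith
  have h2 : 1 - 1 / (16 * rateNum μ L l u) ≤ Real.exp (-(1 / (16 * rateNum μ L l u))) :=
    Real.one_sub_le_exp_neg _
  calc (apdgRule μ L l u).θ ^ N ≤ Real.exp (-(1 / (16 * rateNum μ L l u))) ^ N :=
        pow_le_pow_left₀ h1 h2 N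
    _ = _ := by
      rw [← Real.exp_nat_mul, ← Real.exp_nat_mul]
      congr 1
      field_simp
      ring

end Rule

/-- Linear convergence of APDG with the parameters `apdgRule`. -/
theorem norm_apdg_sub_le {ι κ : Type} [Fintype ι] [DecidableEq ι] [Fintype κ] [DecidableEq κ]
    {A : Matrix κ ι ℝ} (h0 : Aᵀ * A ≠ 0) {μ L : ℝ} (hμ : 0 < μ) (hL : μ ≤ L)
    {f : EuclideanSpace ℝ ι → ℝ} {g : EuclideanSpace ℝ ι → EuclideanSpace ℝ ι}
    (hf : QuadraticBounds μ L f g) {xs : EuclideanSpace ℝ ι} (hxs : A.toEuclideanLin xs = 0)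
    {ys : EuclideanSpace ℝ κ} (hys : ys ∈ A.toEuclideanLin.range)
    (hsad : Aᵀ.toEuclideanLin ys = -g xs) (x₀ : EuclideanSpace ℝ ι) {y₀ : EuclideanSpace ℝ κ}
    (hy₀ : y₀ ∈ A.toEuclideanLin.range) (N : ℕ) :
    ‖(apdg A g (apdgRule μ L (lamMinPos (Aᵀ * A)) (lamMax (Aᵀ * A))) x₀ y₀ N).x - xs‖ ≤
      Real.exp (-(N / (32 * rateNum μ L (lamMinPos (Aᵀ * A)) (lamMax (Aᵀ * A))))) *
        (2 * (L / μ) * (‖x₀ - xs‖ + (‖Aᵀ.toEuclideanLin y₀‖ + ‖g xs‖) / μ)) := by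
  have hpsd := posSemidef_transpose_mul_self A
  have hl := lamMinPos_pos hpsd h0
  have hu := lamMinPos_le_lamMax hpsd h0
  have hL0 : 0 < L := hμ.trans_le hL
  have main := norm_apdg_sub_sq_le (apdgRule_contractive hμ hL hl hu) hμ.le hL0 hf
    (norm_toEuclideanLin_sq_le A) (norm_transpose_toEuclideanLin_sq_le A (hl.le.trans hu)) hl.le
    (fun y hy => lamMinPos_mul_norm_sq_le A h0 hy) hxs hys hsad (x₀ := x₀) hy₀ N
  have hdual := lamMinPos_mul_norm_sq_le A h0 (Submodule.sub_mem _ hy₀ hys)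
  have hp : ‖Aᵀ.toEuclideanLin (y₀ - ys)‖ ≤ ‖Aᵀ.toEuclideanLin y₀‖ + ‖g xs‖ := by
    rw [map_sub, hsad, sub_neg_eq_add]
    exact norm_add_le _ _
  have hθ := apdgRule_theta_pow_le (μ := μ) (L := L) hl hu N
  set l := lamMinPos (Aᵀ * A)
  set u := lamMax (Aᵀ * A)
  set e := ‖(apdg A g (apdgRule μ L l u) x₀ y₀ N).x - xs‖
  set X := ‖x₀ - xs‖ with hX
  set Y := ‖y₀ - ys‖
  set p := ‖Aᵀ.toEuclideanLin (y₀ - ys)‖ with hpdef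
  set R := ‖Aᵀ.toEuclideanLin y₀‖ + ‖g xs‖
  have hκ : 1 ≤ rateNum μ L l u := one_le_rateNum hl hu
  simp only [apdgRule, inv_inv] at main
  set κ := rateNum μ L l u
  have hκ0 : 0 < κ := by linarith
  have hu0 : 0 < u := hl.trans_le hu
  set T := (apdgRule μ L l u).θ ^ N with hT
  change 4 * μ * κ / 2 * e ^ 2 ≤ T * _ at main
  have hr : 1 ≤ L / μ := (one_le_div hμ).mpr hL
  have hX0 : 0 ≤ X := norm_nonneg _
  have hp0 : 0 ≤ p := norm_nonneg _
  have hR0 : 0 ≤ R := hp0.trans hp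
  have hT0 : 0 ≤ T := by
    obtain ⟨-, -, -, -, -, -, -, -, -, h10⟩ := apdgRule_valid hμ hL hl hu
    exact pow_nonneg h10.1.le N
  have b1 : (4 * μ * κ + L * (u / l / κ)⁻¹) * X ^ 2 ≤ 2 * μ * κ * (3 * (L / μ) * X ^ 2) := by
    have c1 : L * (u / l / κ)⁻¹ = L * κ * (l / u) := by field_simp
    have c2 : l / u ≤ 1 := (div_le_one hu0).mpr hu
    have c3 : L * κ * (l / u) ≤ L * κ * 1 := mul_le_mul_of_nonneg_left c2 (by positivity)
    have c4 : 2 * μ * κ * (3 * (L / μ) * X ^ 2) = 6 * (L * κ) * X ^ 2 := by field_simp; ring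
    rw [c4, c1]
    refine mul_le_mul_of_nonneg_right ?_ (sq_nonneg _)
    nlinarith
  -- Both dual coefficients carry a factor `l`, and `l Y² ≤ p² ≤ R²`. Hence the spectrum of `A` does
  -- not enter the initial error.
  have b2 : (2 * l * κ / L + 1 / (4 * L) * l) * Y ^ 2 ≤ 2 * μ * κ * (2 * (R / μ) ^ 2) := by
    calc (2 * l * κ / L + 1 / (4 * L) * l) * Y ^ 2 = (2 * κ + 1 / 4) / L * (l * Y ^ 2) := by
          field_simp
      _ ≤ (2 * κ + 1 / 4) / L * p ^ 2 := by gcongr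
      _ ≤ (4 * κ) / μ * R ^ 2 := by
          gcongr
          linarith
      _ = _ := by field_simp; ring
  have b3 : e ^ 2 ≤ T * (3 * (L / μ) * X ^ 2 + 2 * (R / μ) ^ 2) := by
    have := mul_le_mul_of_nonneg_left (add_le_add b1 b2) hT0
    refine le_of_mul_le_mul_left ?_ (by positivity : 0 < 2 * μ * κ)
    linarith
  have b4 : 3 * (L / μ) * X ^ 2 + 2 * (R / μ) ^ 2 ≤ (2 * (L / μ) * (X + R / μ)) ^ 2 := by
    have c0 : 0 ≤ R / μ := by positivity
    have c1 : L / μ ≤ (L / μ) ^ 2 := by nlinarith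
    have c2 : 1 ≤ (L / μ) ^ 2 := by nlinarith
    have c3 := mul_le_mul_of_nonneg_right c1 (sq_nonneg X)
    have c4 := mul_le_mul_of_nonneg_right c2 (sq_nonneg (R / μ))
    have c5 : 0 ≤ (L / μ) ^ 2 * (X * (R / μ)) := by positivity
    have c6 : 0 ≤ (L / μ) ^ 2 * X ^ 2 := by positivity
    have c7 : (2 * (L / μ) * (X + R / μ)) ^ 2 = 4 * ((L / μ) ^ 2 * X ^ 2)
      + 8 * ((L / μ) ^ 2 * (X * (R / μ))) + 4 * ((L / μ) ^ 2 * (R / μ) ^ 2) := by ring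
    rw [c7]
    linarith [sq_nonneg (R / μ)]
  refine (le_abs_self _).trans (abs_le_of_sq_le_sq ?_ (by positivity))
  rw [mul_pow]
  refine b3.trans (mul_le_mul hθ b4 (by positivity) (sq_nonneg _))

/-- If the logarithm is nonpositive then `V ≤ ε` already, so enlarging `κ` to `K` matters only when
it is positive. The case `V = 0`, where `Real.log 0 = 0`, is trivial. -/
theorem le_of_exp_decay {e V ε κ K n : ℝ} (hκ : 0 < κ) (hK : κ ≤ K) (hV : 0 ≤ V) (hε : 0 < ε)
    (hn : 0 ≤ n) (he : e ≤ Real.exp (-(n / κ)) * V) (h : K * Real.log (V / ε) ≤ n) : e ≤ ε := by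
  refine he.trans ?_
  rcases hV.eq_or_lt with rfl | hV
  · simpa using hε.le
  rcases le_or_gt (Real.log (V / ε)) 0 with h1 | h1
  · have h2 : V / ε ≤ 1 := (Real.log_nonpos_iff (by positivity)).mp h1
    rw [div_le_one hε] at h2
    have h3 : Real.exp (-(n / κ)) ≤ 1 := by
      rw [Real.exp_le_one_iff, neg_nonpos]; positivity
    nlinarith
  · have h2 : Real.log (V / ε) ≤ n / κ := by
      rw [le_div_iff₀ hκ, mul_comm]
      exact (mul_le_mul_of_nonneg_right hK h1.le).trans h
    have h3 : Real.exp (-(n / κ)) ≤ Real.exp (-Real.log (V / ε)) :=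
      Real.exp_le_exp.mpr (neg_le_neg h2)
    rw [Real.exp_neg (Real.log _), Real.exp_log (by positivity), inv_div] at h3
    calc _ ≤ ε / V * V := mul_le_mul_of_nonneg_right h3 hV.le
      _ = ε := by field_simp

/-! ### The Chebyshev polynomials -/

section Chebyshev

/-- The recurrence gives the second difference in `n` as `2(s - 1)T_{n+1}(s) ≥ 2(s - 1)`. Summing
twice gives `n²(s - 1)`, so the induction also carries the first difference. -/
theorem one_add_sq_mul_le_eval_T {s : ℝ} (hs : 1 ≤ s) (n : ℕ) :
    1 + (n : ℝ) ^ 2 * (s - 1) ≤ (Polynomial.Chebyshev.T ℝ n).eval s := by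
  have key : ∀ n : ℕ, 1 + (n : ℝ) ^ 2 * (s - 1) ≤ (Polynomial.Chebyshev.T ℝ n).eval s ∧
      (2 * n + 1) * (s - 1) ≤ (Polynomial.Chebyshev.T ℝ (n + 1)).eval s
        - (Polynomial.Chebyshev.T ℝ n).eval s := by
    intro n
    induction n with
    | zero => simp
    | succ n ih =>
      obtain ⟨h1, h2⟩ := ih
      have h3 := Polynomial.Chebyshev.one_le_eval_T_real ((n : ℤ) + 1) hs
      have h4 : (Polynomial.Chebyshev.T ℝ (((n + 1 : ℕ) : ℤ) + 1)).eval s =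
          2 * s * (Polynomial.Chebyshev.T ℝ ((n : ℤ) + 1)).eval s
            - (Polynomial.Chebyshev.T ℝ n).eval s := by
        rw [show ((n + 1 : ℕ) : ℤ) + 1 = n + 2 by push_cast; ring, Polynomial.Chebyshev.T_add_two]
        simp
      rw [h4]
      push_cast
      constructor
      · nlinarith
      · nlinarith
  exact (key n).1

variable {l u : ℝ}

theorem eval_chebPoly_zero (hl : 0 < l) (hu : l ≤ u) (K : ℕ) : (chebPoly l u K).eval 0 = 0 := by
  rw [chebPoly]
  split_ifs with h
  · simp
  · have hlt : l < u := lt_of_le_of_ne hu h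
    have hs : 1 ≤ (u + l) / (u - l) := by rw [one_le_div (by linarith)]; linarith
    have h1 := Polynomial.Chebyshev.one_le_eval_T_real (K : ℤ) hs
    simp [Polynomial.eval_comp, inv_mul_cancel₀ (by linarith :
      (Polynomial.Chebyshev.T ℝ (K : ℤ)).eval ((u + l) / (u - l)) ≠ 0)]

/-- On `[l, u]` the numerator has absolute value at most `1`, so it suffices that the denominator is
at least `5/3`. -/
theorem eval_chebPoly_mem_Icc (hl : 0 < l) {t : ℝ} (ht : t ∈ Set.Icc l u) :
    (chebPoly l u ⌊√(u / l)⌋₊).eval t ∈ Set.Icc (2 / 5 : ℝ) (8 / 5) := by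
  obtain ⟨htl, htu⟩ := ht
  have hu0 : 0 < u := by linarith
  rw [chebPoly]
  split_ifs with h
  · have : t = u := by linarith
    subst this
    simp only [Polynomial.eval_mul, Polynomial.eval_C, Polynomial.eval_X,
      inv_mul_cancel₀ hu0.ne']
    norm_num
  · have hlt : l < u := lt_of_le_of_ne (htl.trans htu) h
    have hd : 0 < u - l := by linarith
    set K := ⌊√(u / l)⌋₊ with hK
    have hχ : 1 ≤ u / l := by rw [one_le_div hl]; exact hlt.le
    have hK1 : 1 ≤ K := by
      rw [hK, Nat.one_le_floor_iff]
      exact Real.one_le_sqrt.mpr hχ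
    have hK1' : (1 : ℝ) ≤ K := by exact_mod_cast hK1
    have hKlt : √(u / l) < K + 1 := Nat.lt_floor_add_one _
    have hχK : u / l < (K + 1) ^ 2 := by
      rw [← Real.sqrt_lt_sqrt_iff (by positivity), Real.sqrt_sq (by positivity)]
      exact hKlt
    have hs : (u + l) / (u - l) - 1 = 2 * l / (u - l) := by field_simp; ring
    have hT : 5 / 3 ≤ (Polynomial.Chebyshev.T ℝ (K : ℤ)).eval ((u + l) / (u - l)) := by
      refine le_trans ?_ (one_add_sq_mul_le_eval_T ?_ K)
      · rw [hs]
        have : 2 / 3 ≤ (K : ℝ) ^ 2 * (2 * l / (u - l)) := by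
          rw [← mul_div_assoc, le_div_iff₀ hd]
          rw [div_lt_iff₀ hl] at hχK
          -- Since `χ < (K + 1)²` and `K ≥ 1`, this gives `χ - 1 < 3K²`, hence `K² · 2/(χ - 1) ≥
          -- 2/3`.
          have h3 : ((K : ℝ) + 1) ^ 2 ≤ 3 * K ^ 2 + 1 := by nlinarith
          have h4 := mul_le_mul_of_nonneg_right h3 hl.le
          linarith
        linarith
      · rw [one_le_div hd]; linarith
    set T := (Polynomial.Chebyshev.T ℝ (K : ℤ)).eval ((u + l) / (u - l))
    have harg : |(u + l) / (u - l) - 2 / (u - l) * t| ≤ 1 := by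
      have : (u + l) / (u - l) - 2 / (u - l) * t = (u + l - 2 * t) / (u - l) := by ring
      rw [this, abs_le, le_div_iff₀ hd, div_le_iff₀ hd]
      constructor <;> linarith
    have hb := abs_le.mp (Polynomial.Chebyshev.abs_eval_T_real_le_one (K : ℤ) harg)
    simp only [Polynomial.eval_sub, Polynomial.eval_one, Polynomial.eval_mul, Polynomial.eval_C,
      Polynomial.eval_comp, Polynomial.eval_X]
    set r := (Polynomial.Chebyshev.T ℝ (K : ℤ)).eval ((u + l) / (u - l) - 2 / (u - l) * t)
    have hTinv : T⁻¹ ≤ 3 / 5 := by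
      rw [inv_le_comm₀ (by linarith) (by norm_num)]
      norm_num
      exact hT
    have hT0 : 0 < T⁻¹ := by rw [inv_pos]; linarith
    constructor <;> nlinarith [hb.1, hb.2]

theorem natDegree_chebPoly_le (hl : 0 < l) (hu : l ≤ u) :
    ((chebPoly l u ⌊√(u / l)⌋₊).natDegree : ℝ) ≤ √(u / l) := by
  have hχ : 1 ≤ u / l := by rw [one_le_div hl]; exact hu
  rw [chebPoly]
  split_ifs with h
  · refine le_trans ?_ (Real.one_le_sqrt.mpr hχ)
    have : (Polynomial.C u⁻¹ * Polynomial.X).natDegree ≤ 1 :=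
      (Polynomial.natDegree_C_mul_le _ _).trans Polynomial.natDegree_X_le
    exact_mod_cast this
  · refine le_trans ?_ (Nat.floor_le (Real.sqrt_nonneg (u / l)))
    set K := ⌊√(u / l)⌋₊
    norm_cast
    refine (Polynomial.natDegree_sub_le _ _).trans (max_le (by simp) ?_)
    refine (Polynomial.natDegree_C_mul_le _ _).trans (Polynomial.natDegree_comp_le.trans ?_)
    rw [Polynomial.Chebyshev.natDegree_T, Int.natAbs_natCast]
    refine (Nat.mul_le_mul_left K (?_ : _ ≤ 1)).trans (by simp)
    refine (Polynomial.natDegree_sub_le _ _).trans (max_le (by simp) ?_)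
    exact (Polynomial.natDegree_C_mul_le _ _).trans Polynomial.natDegree_X_le

end Chebyshev

/-! ### The Chebyshev polynomial of a matrix -/

section ChebMatrix

variable {ι : Type} [Fintype ι] [DecidableEq ι] {M : Matrix ι ι ℝ}

theorem natDegree_cheb_le (hM : M.PosSemidef) (h0 : M ≠ 0) :
    ((cheb M).natDegree : ℝ) ≤ √(condNum M) :=
  natDegree_chebPoly_le (lamMinPos_pos hM h0) (lamMinPos_le_lamMax hM h0)

theorem eval_cheb_zero (hM : M.PosSemidef) (h0 : M ≠ 0) : (cheb M).eval 0 = 0 :=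
  eval_chebPoly_zero (lamMinPos_pos hM h0) (lamMinPos_le_lamMax hM h0) _

theorem eval_cheb_mem_Icc (hM : M.PosSemidef) (h0 : M ≠ 0) {t : ℝ} (ht : t ∈ spectrum ℝ M)
    (ht0 : t ≠ 0) : (cheb M).eval t ∈ Set.Icc (2 / 5 : ℝ) (8 / 5) :=
  have := nonempty_of_matrix_ne_zero h0
  eval_chebPoly_mem_Icc (lamMinPos_pos hM h0)
    ⟨(isLeast_lamMinPos hM.1 h0).2 ⟨ht, ht0⟩, (isGreatest_lamMax hM.1).2 ht⟩

theorem eval_cheb_eq_zero_iff (hM : M.PosSemidef) (h0 : M ≠ 0) {t : ℝ} (ht : t ∈ spectrum ℝ M) :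
    (cheb M).eval t = 0 ↔ t = 0 := by
  constructor
  · intro h
    by_contra ht0
    have := (eval_cheb_mem_Icc hM h0 ht ht0).1
    linarith
  · rintro rfl
    exact eval_cheb_zero hM h0

/-- On the spectrum the polynomial vanishes only at `0`. This is why acceleration leaves the
feasible set unchanged. -/
theorem aeval_cheb_mulVec_eq_zero_iff (hM : M.PosSemidef) (h0 : M ≠ 0) (x : ι → ℝ) :
    Polynomial.aeval M (cheb M) *ᵥ x = 0 ↔ M *ᵥ x = 0 := by
  obtain ⟨U, D, h⟩ := IsDiagonalization.exists_of_isHermitian hM.1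
  rw [(h.aeval (cheb M)).mulVec_eq_zero_iff, h.mulVec_eq_zero_iff]
  refine forall_congr' fun i => ?_
  rw [eval_cheb_eq_zero_iff hM h0 (h.spectrum_eq ▸ ⟨i, rfl⟩)]

theorem aeval_cheb_posSemidef (hM : M.PosSemidef) (h0 : M ≠ 0) :
    (Polynomial.aeval M (cheb M)).PosSemidef := by
  obtain ⟨U, D, h⟩ := IsDiagonalization.exists_of_isHermitian hM.1
  rw [(h.aeval (cheb M)).posSemidef_iff]
  intro i
  by_cases hi : D i = 0
  · rw [hi, eval_cheb_zero hM h0]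
  · have := (eval_cheb_mem_Icc hM h0 (h.spectrum_eq ▸ ⟨i, rfl⟩) hi).1
    linarith

theorem aeval_cheb_ne_zero (hM : M.PosSemidef) (h0 : M ≠ 0) :
    Polynomial.aeval M (cheb M) ≠ 0 := by
  obtain ⟨U, D, h⟩ := IsDiagonalization.exists_of_isHermitian hM.1
  intro hz
  rw [(h.aeval (cheb M)).eq_zero_iff] at hz
  refine h0 (h.eq_zero_iff.mpr fun i => ?_)
  rw [← eval_cheb_eq_zero_iff hM h0 (h.spectrum_eq ▸ ⟨i, rfl⟩)]
  exact hz i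

theorem condNum_aeval_cheb_le (hM : M.PosSemidef) (h0 : M ≠ 0) :
    condNum (Polynomial.aeval M (cheb M)) ≤ 4 := by
  have := nonempty_of_matrix_ne_zero h0
  have hN := aeval_cheb_posSemidef hM h0
  have hN0 := aeval_cheb_ne_zero hM h0
  obtain ⟨U, D, h⟩ := IsDiagonalization.exists_of_isHermitian hM.1
  have h' := h.aeval (cheb M)
  have hspec : ∀ t ∈ spectrum ℝ (Polynomial.aeval M (cheb M)), t ≠ 0 →
      t ∈ Set.Icc (2 / 5 : ℝ) (8 / 5) := by
    rw [h'.spectrum_eq]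
    rintro _ ⟨i, rfl⟩ hi
    refine eval_cheb_mem_Icc hM h0 (h.spectrum_eq ▸ ⟨i, rfl⟩) fun hz => hi ?_
    simp only [hz, eval_cheb_zero hM h0]
  have h1 := hspec _ (isGreatest_lamMax hN.1).1 (lamMax_pos hN hN0).ne'
  have h2 := hspec _ (isLeast_lamMinPos hN.1 hN0).1.1 (isLeast_lamMinPos hN.1 hN0).1.2
  rw [condNum, div_le_iff₀ (lamMinPos_pos hN hN0)]
  linarith [h1.2, h2.1]

end ChebMatrix

/-! ### The spectrum of `I ⊗ Q + γ² W² ⊗ I` -/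

section Gram

theorem bigB_transpose {m d q : ℕ} (B : Matrix (Fin q) (Fin d) ℝ) : (bigB m B)ᵀ = bigB m Bᵀ := by
  rw [bigB, bigB, ← Matrix.kroneckerMap_transpose, Matrix.transpose_one]

theorem bigW_transpose {m d : ℕ} {W : Matrix (Fin m) (Fin m) ℝ} (hW : W.IsHermitian) :
    (bigW d W)ᵀ = bigW d W := by
  have hWt : Wᵀ = W := by
    simpa [Matrix.IsHermitian, Matrix.conjTranspose_eq_transpose_of_trivial] using hW
  rw [bigW, ← Matrix.kroneckerMap_transpose, Matrix.transpose_one, hWt]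

variable {m d : ℕ}

theorem conMat_gram {q : ℕ} (B : Matrix (Fin q) (Fin d) ℝ) {W : Matrix (Fin m) (Fin m) ℝ}
    (hW : W.IsHermitian) (γ : ℝ) :
    (conMat B W γ)ᵀ * conMat B W γ = bigB m (Bᵀ * B) + γ ^ 2 • bigW d (W * W) := by
  have e3 : bigB m Bᵀ * bigB m B = bigB m (Bᵀ * B) := by
    rw [bigB, bigB, bigB, ← Matrix.mul_kronecker_mul, Matrix.one_mul]
  have e4 : bigW d W * bigW d W = bigW d (W * W) := by
    rw [bigW, bigW, ← Matrix.mul_kronecker_mul, Matrix.one_mul]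
  rw [conMat, Matrix.transpose_fromRows, Matrix.fromCols_mul_fromRows, Matrix.transpose_smul,
    bigB_transpose, bigW_transpose hW, Matrix.smul_mul, Matrix.mul_smul, smul_smul, e3, e4, sq]

variable {Q : Matrix (Fin d) (Fin d) ℝ} {W : Matrix (Fin m) (Fin m) ℝ}

/-- Kronecker products of eigenvectors of `W` and `Q` diagonalize both summands at once. -/
theorem spectrum_gram (hQ : Q.IsHermitian) (hW : W.IsHermitian) (γ : ℝ) :
    spectrum ℝ (bigB m Q + γ ^ 2 • bigW d (W * W)) =
      Set.image2 (fun β ω => β + γ ^ 2 * ω ^ 2) (spectrum ℝ Q) (spectrum ℝ W) := by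
  obtain ⟨U, D, hU⟩ := IsDiagonalization.exists_of_isHermitian hW
  obtain ⟨V, E, hV⟩ := IsDiagonalization.exists_of_isHermitian hQ
  have h1 := (IsDiagonalization.one hU.orth).kronecker hV
  have h2 := ((hU.mul hU).kronecker (IsDiagonalization.one hV.orth)).smul (γ ^ 2)
  rw [bigB, bigW, (h1.add h2).spectrum_eq, hU.spectrum_eq, hV.spectrum_eq]
  ext t
  simp only [Set.mem_range, Set.mem_image2, Prod.exists]
  constructor
  · rintro ⟨i, j, rfl⟩
    exact ⟨_, ⟨j, rfl⟩, _, ⟨i, rfl⟩, by ring⟩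
  · rintro ⟨_, ⟨j, rfl⟩, _, ⟨i, rfl⟩, rfl⟩
    exact ⟨i, j, by ring⟩

theorem zero_mem_spectrum_of_mulVec_eq_zero {ι : Type} [Fintype ι] [DecidableEq ι]
    {M : Matrix ι ι ℝ} (hM : M.IsHermitian) {x : ι → ℝ} (hx : x ≠ 0) (h : M *ᵥ x = 0) :
    0 ∈ spectrum ℝ M := by
  obtain ⟨U, D, hU⟩ := IsDiagonalization.exists_of_isHermitian hM
  rw [hU.mulVec_eq_zero_iff] at h
  rw [hU.spectrum_eq]
  by_contra hn
  have h1 : Uᵀ *ᵥ x = 0 := funext fun i => (h i).resolve_left fun hi => hn ⟨i, hi⟩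
  apply hx
  rw [← Matrix.one_mulVec x, ← hU.orth', ← Matrix.mulVec_mulVec, h1, Matrix.mulVec_zero]

theorem lamMax_gram (hQ : Q.PosSemidef) (hW : W.PosSemidef) (hQ0 : Q ≠ 0) (hW0 : W ≠ 0) (γ : ℝ) :
    lamMax (bigB m Q + γ ^ 2 • bigW d (W * W)) = lamMax Q + γ ^ 2 * lamMax W ^ 2 := by
  have := nonempty_of_matrix_ne_zero hQ0
  have := nonempty_of_matrix_ne_zero hW0
  have h1 := isGreatest_lamMax hQ.1
  have h2 := isGreatest_lamMax hW.1
  refine IsGreatest.csSup_eq ?_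
  rw [spectrum_gram hQ.1 hW.1]
  refine ⟨⟨_, h1.1, _, h2.1, rfl⟩, ?_⟩
  rintro _ ⟨β, hβ, ω, hω, rfl⟩
  have hω0 := spectrum_nonneg hW hω
  have := h1.2 hβ
  have := h2.2 hω
  dsimp only
  gcongr

/-- Pairing `0` in one spectrum with the least nonzero eigenvalue of the other attains each term of
the minimum; hence both matrices must be singular. -/
theorem lamMinPos_gram (hQ : Q.PosSemidef) (hW : W.PosSemidef) (hQ0 : Q ≠ 0) (hW0 : W ≠ 0)
    (hQz : 0 ∈ spectrum ℝ Q) (hWz : 0 ∈ spectrum ℝ W) {γ : ℝ} (hγ : 0 < γ) :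
    lamMinPos (bigB m Q + γ ^ 2 • bigW d (W * W)) =
      min (lamMinPos Q) (γ ^ 2 * lamMinPos W ^ 2) := by
  have h1 := isLeast_lamMinPos hQ.1 hQ0
  have h2 := isLeast_lamMinPos hW.1 hW0
  have p1 := lamMinPos_pos hQ hQ0
  have p2 := lamMinPos_pos hW hW0
  refine IsLeast.csInf_eq ?_
  rw [spectrum_gram hQ.1 hW.1]
  constructor
  · rcases min_choice (lamMinPos Q) (γ ^ 2 * lamMinPos W ^ 2) with h | h <;> rw [h]
    · exact ⟨⟨_, h1.1.1, 0, hWz, by simp⟩, h1.1.2⟩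
    · refine ⟨⟨0, hQz, _, h2.1.1, by simp⟩, ?_⟩
      simp only [Set.mem_singleton_iff]
      positivity
  · rintro _ ⟨⟨β, hβ, ω, hω, rfl⟩, hne⟩
    have hβ0 := spectrum_nonneg hQ hβ
    have hω0 := spectrum_nonneg hW hω
    simp only [Set.mem_singleton_iff] at hne
    by_cases hz : β = 0
    · have hωz : ω ≠ 0 := by rintro rfl; simp [hz] at hne
      have := h2.2 ⟨hω, hωz⟩
      refine (min_le_right _ _).trans ?_
      dsimp only
      rw [hz, zero_add]
      gcongr
    · have := h1.2 ⟨hβ, hz⟩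
      refine (min_le_left _ _).trans ?_
      dsimp only
      have : 0 ≤ γ ^ 2 * ω ^ 2 := by positivity
      linarith

theorem gram_ne_zero (hQ : Q.PosSemidef) (hQ0 : Q ≠ 0) (hW : W.PosSemidef) (hW0 : W ≠ 0)
    (γ : ℝ) : bigB m Q + γ ^ 2 • bigW d (W * W) ≠ 0 := by
  intro h
  have h1 := lamMax_gram hQ hW hQ0 hW0 γ
  have := nonempty_of_matrix_ne_zero hQ0
  have := nonempty_of_matrix_ne_zero hW0
  have h2 := lamMax_pos hQ hQ0
  have h3 : lamMax (0 : Matrix (Fin m × Fin d) (Fin m × Fin d) ℝ) = 0 := by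
    rw [lamMax, spectrum.zero_eq, csSup_singleton]
  rw [h, h3] at h1
  have : 0 ≤ γ ^ 2 * lamMax W ^ 2 := by positivity
  linarith

theorem gammaOpt_pos (hQ : Q.PosSemidef) (hQ0 : Q ≠ 0) (hW : W.PosSemidef) (hW0 : W ≠ 0) :
    0 < gammaOpt Q W :=
  div_pos (Real.sqrt_pos.mpr (lamMinPos_pos hQ hQ0)) (lamMinPos_pos hW hW0)

theorem condNum_gram_gammaOpt (hQ : Q.PosSemidef) (hW : W.PosSemidef) (hQ0 : Q ≠ 0) (hW0 : W ≠ 0)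
    (hQz : 0 ∈ spectrum ℝ Q) (hWz : 0 ∈ spectrum ℝ W) :
    condNum (bigB m Q + gammaOpt Q W ^ 2 • bigW d (W * W)) = condNum W ^ 2 + condNum Q := by
  have p1 := lamMinPos_pos hQ hQ0
  have p2 := lamMinPos_pos hW hW0
  have hγ : gammaOpt Q W ^ 2 = lamMinPos Q / lamMinPos W ^ 2 := by
    rw [gammaOpt, div_pow, Real.sq_sqrt p1.le]
  rw [condNum, lamMax_gram hQ hW hQ0 hW0,
    lamMinPos_gram hQ hW hQ0 hW0 hQz hWz (gammaOpt_pos hQ hQ0 hW hW0), hγ,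
    div_mul_cancel₀ _ (by positivity), min_self, condNum, condNum]
  field_simp
  ring

/-- Split the numerator and bound the minimum in the denominator by the matching term: `γ` cancels
from the `W` part. Equality holds when the two terms of the minimum agree. -/
theorem le_condNum_gram (hQ : Q.PosSemidef) (hW : W.PosSemidef) (hQ0 : Q ≠ 0) (hW0 : W ≠ 0)
    (hQz : 0 ∈ spectrum ℝ Q) (hWz : 0 ∈ spectrum ℝ W) {γ : ℝ} (hγ : 0 < γ) :
    condNum W ^ 2 + condNum Q ≤ condNum (bigB m Q + γ ^ 2 • bigW d (W * W)) := by
  have p1 := lamMinPos_pos hQ hQ0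
  have p2 := lamMinPos_pos hW hW0
  have q1 := lamMax_pos hQ hQ0
  have q2 := lamMax_pos hW hW0
  rw [condNum, condNum, condNum, lamMax_gram hQ hW hQ0 hW0,
    lamMinPos_gram hQ hW hQ0 hW0 hQz hWz hγ, add_div, add_comm, div_pow]
  have hm : 0 < min (lamMinPos Q) (γ ^ 2 * lamMinPos W ^ 2) := lt_min p1 (by positivity)
  refine add_le_add (div_le_div_of_nonneg_left q1.le hm (min_le_left _ _)) ?_
  calc lamMax W ^ 2 / lamMinPos W ^ 2
      = γ ^ 2 * lamMax W ^ 2 / (γ ^ 2 * lamMinPos W ^ 2) := by field_simp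
    _ ≤ _ := div_le_div_of_nonneg_left (by positivity) hm (min_le_right _ _)

end Gram

/-! ### Values and costs of programs -/

namespace Prog

variable {m d p : ℕ} (P : Problem m d p) {α β : Type}

@[simp] theorem out_pure (a : α) : (pure a : Prog m d p α).out P = a := rfl

@[simp] theorem gradCalls_pure (a : α) : (pure a : Prog m d p α).gradCalls P = 0 := rfl

@[simp] theorem commRounds_pure (a : α) : (pure a : Prog m d p α).commRounds P = 0 := rfl

@[simp] theorem multsB_pure (a : α) : (pure a : Prog m d p α).multsB P = 0 := rfl

@[simp] theorem out_bind (x : Prog m d p α) (f : α → Prog m d p β) :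
    (x >>= f).out P = (f (x.out P)).out P := by
  change (x.andThen f).out P = _
  induction x with
  | ret a => rfl
  | grad x k ih | comm x k ih | mulB x k ih | mulBT x k ih =>
    simp only [andThen, out]
    exact ih _

@[simp] theorem gradCalls_bind (x : Prog m d p α) (f : α → Prog m d p β) :
    (x >>= f).gradCalls P = x.gradCalls P + (f (x.out P)).gradCalls P := by
  change (x.andThen f).gradCalls P = _
  induction x with
  | ret a => simp only [andThen, gradCalls, out, zero_add]
  | grad x k ih | comm x k ih | mulB x k ih | mulBT x k ih =>
    simp only [andThen, gradCalls, out]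
    rw [ih]
    try omega

@[simp] theorem commRounds_bind (x : Prog m d p α) (f : α → Prog m d p β) :
    (x >>= f).commRounds P = x.commRounds P + (f (x.out P)).commRounds P := by
  change (x.andThen f).commRounds P = _
  induction x with
  | ret a => simp only [andThen, commRounds, out, zero_add]
  | grad x k ih | comm x k ih | mulB x k ih | mulBT x k ih =>
    simp only [andThen, commRounds, out]
    rw [ih]
    try omega

@[simp] theorem multsB_bind (x : Prog m d p α) (f : α → Prog m d p β) :
    (x >>= f).multsB P = x.multsB P + (f (x.out P)).multsB P := by
  change (x.andThen f).multsB P = _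
  induction x with
  | ret a => simp only [andThen, multsB, out, zero_add]
  | grad x k ih | comm x k ih | mulB x k ih | mulBT x k ih =>
    simp only [andThen, multsB, out]
    rw [ih]
    try omega

@[simp] theorem out_callGrad (x : Stack m d) :
    (callGrad x : Prog m d p _).out P = P.gradF x := rfl

@[simp] theorem out_callW (x : Stack m d) :
    (callW x : Prog m d p _).out P = (bigW d P.W).toEuclideanLin x := rfl

@[simp] theorem out_callB (x : Stack m d) :
    (callB x : Prog m d p _).out P = (bigB m P.B).toEuclideanLin x := rfl

@[simp] theorem out_callBT (u : Stack m p) :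
    (callBT u : Prog m d p _).out P = (bigB m P.Bᵀ).toEuclideanLin u := rfl

@[simp] theorem gradCalls_callGrad (x : Stack m d) :
    (callGrad x : Prog m d p _).gradCalls P = 1 := rfl

@[simp] theorem gradCalls_callW (x : Stack m d) :
    (callW x : Prog m d p _).gradCalls P = 0 := rfl

@[simp] theorem gradCalls_callB (x : Stack m d) :
    (callB x : Prog m d p _).gradCalls P = 0 := rfl

@[simp] theorem gradCalls_callBT (u : Stack m p) :
    (callBT u : Prog m d p _).gradCalls P = 0 := rfl

@[simp] theorem commRounds_callGrad (x : Stack m d) :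
    (callGrad x : Prog m d p _).commRounds P = 0 := rfl

@[simp] theorem commRounds_callW (x : Stack m d) :
    (callW x : Prog m d p _).commRounds P = 1 := rfl

@[simp] theorem commRounds_callB (x : Stack m d) :
    (callB x : Prog m d p _).commRounds P = 0 := rfl

@[simp] theorem commRounds_callBT (u : Stack m p) :
    (callBT u : Prog m d p _).commRounds P = 0 := rfl

@[simp] theorem multsB_callGrad (x : Stack m d) :
    (callGrad x : Prog m d p _).multsB P = 0 := rfl

@[simp] theorem multsB_callW (x : Stack m d) :
    (callW x : Prog m d p _).multsB P = 0 := rfl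

@[simp] theorem multsB_callB (x : Stack m d) :
    (callB x : Prog m d p _).multsB P = 1 := rfl

@[simp] theorem multsB_callBT (u : Stack m p) :
    (callBT u : Prog m d p _).multsB P = 1 := rfl

theorem out_callA (γ : ℝ) (x : Stack m d) :
    (callA γ x : Prog m d p _).out P = (conMat P.B P.W γ).toEuclideanLin x := by
  simp only [callA, out_bind, out_pure, out_callB, out_callW, conMat, Matrix.toLpLin_apply,
    Matrix.fromRows_mulVec, Matrix.smul_mulVec]

theorem out_callAT (hW : P.W.IsHermitian) (γ : ℝ) (y : Mult m p d) :
    (callAT γ y : Prog m d p _).out P = (conMat P.B P.W γ)ᵀ.toEuclideanLin y := by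
  simp only [callAT, out_bind, out_pure, out_callBT, out_callW, conMat,
    Matrix.transpose_fromRows, Matrix.transpose_smul, bigB_transpose, bigW_transpose hW,
    Matrix.toLpLin_apply, Matrix.fromCols_mulVec, Matrix.smul_mulVec]
  rfl

theorem out_apdgStep (hW : P.W.IsHermitian) (γ : ℝ) (c : APDGParams)
    (s : APDGState (Stack m d) (Mult m p d)) :
    (Prog.apdgStep γ c s).out P = DecOpt.apdgStep (conMat P.B P.W γ) P.gradF c s := by
  simp only [Prog.apdgStep, out_bind, out_pure, out_callA, out_callAT P hW, out_callGrad]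
  rfl

theorem out_apdg (hW : P.W.IsHermitian) (γ : ℝ) (c : APDGParams) (x₀ : Stack m d)
    (y₀ : Mult m p d) (N : ℕ) :
    (Prog.apdg γ c x₀ y₀ N).out P = DecOpt.apdg (conMat P.B P.W γ) P.gradF c x₀ y₀ N := by
  induction N with
  | zero => rfl
  | succ N ih => rw [Prog.apdg, out_bind, ih, out_apdgStep P hW, DecOpt.apdg]

theorem gradCalls_apdg (γ : ℝ) (c : APDGParams) (x₀ : Stack m d) (y₀ : Mult m p d) (N : ℕ) :
    (Prog.apdg γ c x₀ y₀ N).gradCalls P = N := by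
  induction N with
  | zero => rfl
  | succ N ih =>
    rw [Prog.apdg, gradCalls_bind, ih]
    simp [Prog.apdgStep, callA, callAT]

/-- Each iteration has three products with `A` and three with `Aᵀ`, each using one communication. -/
theorem commRounds_apdg (γ : ℝ) (c : APDGParams) (x₀ : Stack m d) (y₀ : Mult m p d) (N : ℕ) :
    (Prog.apdg γ c x₀ y₀ N).commRounds P = 6 * N := by
  induction N with
  | zero => rfl
  | succ N ih =>
    rw [Prog.apdg, commRounds_bind, ih]
    simp [Prog.apdgStep, callA, callAT]
    ring

/-! ### Horner's rule -/

section Horner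

variable {op : Stack m d → Prog m d p (Stack m d)} (q : Polynomial ℝ) (x : Stack m d)

/-- The invariant: the accumulator holds the top `j + 1` coefficients of `q`, read as a polynomial
of degree `j` in `T`. -/
theorem out_hornerAux {T : Matrix (Fin m × Fin d) (Fin m × Fin d) ℝ}
    (hT : ∀ z, (op z).out P = T.toEuclideanLin z) {j : ℕ} (hj : j ≤ q.natDegree) :
    (hornerAux op q x j).out P =
      (∑ i ∈ Finset.range (j + 1), q.coeff (q.natDegree - j + i) • T ^ i).toEuclideanLin x := by
  induction j with
  | zero => simp [hornerAux]
  | succ j ih =>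
    rw [hornerAux, out_bind, out_bind, out_pure, hT, ih (by omega), ← toEuclideanLin_mul_apply,
      Finset.sum_range_succ' _ (j + 1), Finset.mul_sum, map_add, LinearMap.add_apply]
    congr 2
    · congr 1
      refine Finset.sum_congr rfl fun i _ => ?_
      rw [Matrix.mul_smul, pow_succ', show q.natDegree - (j + 1) + (i + 1) = q.natDegree - j + i
        by omega]
    · simp

theorem out_horner {T : Matrix (Fin m × Fin d) (Fin m × Fin d) ℝ}
    (hT : ∀ z, (op z).out P = T.toEuclideanLin z) :
    (horner op q x).out P = (Polynomial.aeval T q).toEuclideanLin x := by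
  rw [horner, out_hornerAux P q x hT le_rfl, Polynomial.aeval_eq_sum_range]
  simp

theorem gradCalls_horner {n : ℕ} (hn : ∀ z, (op z).gradCalls P = n) :
    (horner op q x).gradCalls P = q.natDegree * n := by
  rw [horner]
  generalize hk : q.natDegree = k
  clear hk
  induction k with
  | zero => simp [hornerAux]
  | succ j ih => simp [hornerAux, ih, hn]; ring

theorem commRounds_horner {n : ℕ} (hn : ∀ z, (op z).commRounds P = n) :
    (horner op q x).commRounds P = q.natDegree * n := by
  rw [horner]
  generalize hk : q.natDegree = k
  clear hk
  induction k with
  | zero => simp [hornerAux]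
  | succ j ih => simp [hornerAux, ih, hn]; ring

theorem multsB_horner {n : ℕ} (hn : ∀ z, (op z).multsB P = n) :
    (horner op q x).multsB P = q.natDegree * n := by
  rw [horner]
  generalize hk : q.natDegree = k
  clear hk
  induction k with
  | zero => simp [hornerAux]
  | succ j ih => simp [hornerAux, ih, hn]; ring

end Horner

end Prog

/-! ### Polynomials of Kronecker factors, and the accelerated method as APDG -/

theorem aeval_bigW {m : ℕ} (d : ℕ) (W : Matrix (Fin m) (Fin m) ℝ) (q : Polynomial ℝ) :
    Polynomial.aeval (bigW d W) q = bigW d (Polynomial.aeval W q) := by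
  let φ : Matrix (Fin m) (Fin m) ℝ →ₐ[ℝ] Matrix (Fin m × Fin d) (Fin m × Fin d) ℝ :=
    AlgHom.ofLinearMap
      { toFun := bigW d
        map_add' := fun X Y => Matrix.add_kronecker X Y 1
        map_smul' := fun r X => Matrix.smul_kronecker r X 1 }
      Matrix.one_kronecker_one
      fun X Y => by
        change (X * Y) ⊗ₖ 1 = X ⊗ₖ 1 * Y ⊗ₖ 1
        rw [← Matrix.mul_kronecker_mul, Matrix.one_mul]
  exact Polynomial.aeval_algHom_apply φ W q

theorem aeval_bigB {d : ℕ} (m : ℕ) (Q : Matrix (Fin d) (Fin d) ℝ) (q : Polynomial ℝ) :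
    Polynomial.aeval (bigB m Q) q = bigB m (Polynomial.aeval Q q) := by
  let φ : Matrix (Fin d) (Fin d) ℝ →ₐ[ℝ] Matrix (Fin m × Fin d) (Fin m × Fin d) ℝ :=
    AlgHom.ofLinearMap
      { toFun := bigB m
        map_add' := fun X Y => Matrix.kronecker_add 1 X Y
        map_smul' := fun r X => Matrix.kronecker_smul r 1 X }
      Matrix.one_kronecker_one
      fun X Y => by
        change (1 : Matrix (Fin m) (Fin m) ℝ) ⊗ₖ (X * Y) = 1 ⊗ₖ X * 1 ⊗ₖ Y
        rw [← Matrix.mul_kronecker_mul, Matrix.one_mul]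
  exact Polynomial.aeval_algHom_apply φ Q q

/-- Replaces the multipliers `y` of a state by `p = Aᵀ y`. -/
noncomputable def APDGState.pullback {ι κ : Type} [Fintype ι] [DecidableEq ι] [Fintype κ]
    [DecidableEq κ] (A : Matrix κ ι ℝ)
    (s : APDGState (EuclideanSpace ℝ ι) (EuclideanSpace ℝ κ)) :
    APDGState (EuclideanSpace ℝ ι) (EuclideanSpace ℝ ι) :=
  ⟨s.x, s.xf, Aᵀ.toEuclideanLin s.y, Aᵀ.toEuclideanLin s.yPrev, Aᵀ.toEuclideanLin s.yf⟩

namespace Prog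

variable {m d p : ℕ} (P : Problem m d p)

theorem out_callBTB (x : Stack m d) :
    (callBTB x : Prog m d p _).out P = (bigB m (P.Bᵀ * P.B)).toEuclideanLin x := by
  simp only [callBTB, out_bind, out_callB, out_callBT]
  rw [← toEuclideanLin_mul_apply, bigB, bigB, bigB, ← Matrix.mul_kronecker_mul, Matrix.one_mul]

theorem out_callGram (qW qB : Polynomial ℝ) (γ : ℝ) (x : Stack m d) :
    (callGram qW qB γ x : Prog m d p _).out P =
      (bigB m (Polynomial.aeval (P.Bᵀ * P.B) qB) + γ ^ 2 • bigW d (Polynomial.aeval P.W qW *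
        Polynomial.aeval P.W qW)).toEuclideanLin x := by
  have h1 : bigW d (Polynomial.aeval P.W qW * Polynomial.aeval P.W qW) =
      bigW d (Polynomial.aeval P.W qW) * bigW d (Polynomial.aeval P.W qW) := by
    rw [bigW, bigW, ← Matrix.mul_kronecker_mul, Matrix.one_mul]
  simp only [callGram, out_bind, out_pure, out_horner P qB x (out_callBTB P),
    out_horner P qW _ (out_callW P), aeval_bigB, aeval_bigW]
  rw [map_add, map_smul, LinearMap.add_apply, LinearMap.smul_apply, h1, toEuclideanLin_mul_apply]

theorem gradCalls_callGram (qW qB : Polynomial ℝ) (γ : ℝ) (x : Stack m d) :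
    (callGram qW qB γ x : Prog m d p _).gradCalls P = 0 := by
  have h1 : ∀ z, (callBTB z : Prog m d p _).gradCalls P = 0 := fun z => by simp [callBTB]
  simp [callGram, gradCalls_horner P _ _ h1, gradCalls_horner P _ _ (gradCalls_callW P)]

theorem commRounds_callGram (qW qB : Polynomial ℝ) (γ : ℝ) (x : Stack m d) :
    (callGram qW qB γ x : Prog m d p _).commRounds P = 2 * qW.natDegree := by
  have h1 : ∀ z, (callBTB z : Prog m d p _).commRounds P = 0 := fun z => by simp [callBTB]
  simp [callGram, commRounds_horner P _ _ h1, commRounds_horner P _ _ (commRounds_callW P)]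
  ring

theorem multsB_callGram (qW qB : Polynomial ℝ) (γ : ℝ) (x : Stack m d) :
    (callGram qW qB γ x : Prog m d p _).multsB P = 2 * qB.natDegree := by
  have h1 : ∀ z, (callBTB z : Prog m d p _).multsB P = 2 := fun z => by simp [callBTB]
  simp [callGram, multsB_horner P _ _ h1, multsB_horner P _ _ (multsB_callW P)]
  ring

variable (qW qB : Polynomial ℝ) (γ : ℝ) (c : APDGParams)

theorem gradCalls_acc (x₀ p₀ : Stack m d) (N : ℕ) :
    (acc qW qB γ c x₀ p₀ N : Prog m d p _).gradCalls P = N := by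
  induction N with
  | zero => rfl
  | succ N ih =>
    rw [acc, gradCalls_bind, ih]
    simp [accStep, gradCalls_callGram]

theorem commRounds_acc (x₀ p₀ : Stack m d) (N : ℕ) :
    (acc qW qB γ c x₀ p₀ N : Prog m d p _).commRounds P = 6 * (N * qW.natDegree) := by
  induction N with
  | zero => simp [acc]
  | succ N ih =>
    rw [acc, commRounds_bind, ih]
    simp [accStep, commRounds_callGram]
    ring

theorem multsB_acc (x₀ p₀ : Stack m d) (N : ℕ) :
    (acc qW qB γ c x₀ p₀ N : Prog m d p _).multsB P = 6 * (N * qB.natDegree) := by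
  induction N with
  | zero => simp [acc]
  | succ N ih =>
    rw [acc, multsB_bind, ih]
    simp [accStep, multsB_callGram]
    ring

/-- The `x`-update sees the multipliers only through `Aᵀ`, and every increment of `y` lies in `range
A`. Applying `Aᵀ` to the `y`-update therefore leaves only products with `AᵀA`. -/
theorem out_accStep_pullback {κ : Type} [Fintype κ] [DecidableEq κ]
    {A : Matrix κ (Fin m × Fin d) ℝ}
    (hA : Aᵀ * A = bigB m (Polynomial.aeval (P.Bᵀ * P.B) qB) + γ ^ 2 • bigW d
      (Polynomial.aeval P.W qW * Polynomial.aeval P.W qW))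
    (s : APDGState (Stack m d) (EuclideanSpace ℝ κ)) :
    (accStep qW qB γ c (s.pullback A)).out P =
      (DecOpt.apdgStep A P.gradF c s).pullback A := by
  have hG : ∀ z, (callGram qW qB γ z : Prog m d p _).out P =
      Aᵀ.toEuclideanLin (A.toEuclideanLin z) := by
    intro z
    rw [out_callGram, ← hA, toEuclideanLin_mul_apply]
  simp only [accStep, out_bind, out_pure, hG, out_callGrad]
  simp only [APDGState.pullback, DecOpt.apdgStep, map_add, map_sub, map_smul]

theorem out_acc {κ : Type} [Fintype κ] [DecidableEq κ] {A : Matrix κ (Fin m × Fin d) ℝ}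
    (hA : Aᵀ * A = bigB m (Polynomial.aeval (P.Bᵀ * P.B) qB) + γ ^ 2 • bigW d
      (Polynomial.aeval P.W qW * Polynomial.aeval P.W qW))
    (x₀ : Stack m d) (y₀ : EuclideanSpace ℝ κ) (N : ℕ) :
    (acc qW qB γ c x₀ (Aᵀ.toEuclideanLin y₀) N : Prog m d p _).out P =
      (DecOpt.apdg A P.gradF c x₀ y₀ N).pullback A := by
  induction N with
  | zero => rfl
  | succ N ih => rw [acc, out_bind, ih, out_accStep_pullback P qW qB γ c hA, DecOpt.apdg]

end Prog

/-! ### Ranges and kernels -/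

section Range

variable {ι κ : Type} [Fintype ι] [DecidableEq ι] [Fintype κ] [DecidableEq κ]

theorem mem_range_transpose_iff (A : Matrix κ ι ℝ) (z : EuclideanSpace ℝ ι) :
    z ∈ Aᵀ.toEuclideanLin.range ↔ ∀ w, A.toEuclideanLin w = 0 → inner ℝ w z = 0 := by
  have h := Matrix.toEuclideanLin_conjTranspose_eq_adjoint A
  rw [Matrix.conjTranspose_eq_transpose_of_trivial] at h
  rw [h, ← LinearMap.orthogonal_ker, Submodule.mem_orthogonal]
  rfl

/-- Because `ker AᵀA = ker A`, the ranges of `AᵀA` and `Aᵀ` coincide. This places multipliers in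
`range A`, where the lower bound on `‖Aᵀy‖` holds. -/
theorem exists_mem_range_of_mem_range_transpose (A : Matrix κ ι ℝ) {z : EuclideanSpace ℝ ι}
    (hz : z ∈ Aᵀ.toEuclideanLin.range) :
    ∃ y ∈ A.toEuclideanLin.range, Aᵀ.toEuclideanLin y = z := by
  have h : z ∈ (Aᵀ * A)ᵀ.toEuclideanLin.range := by
    rw [mem_range_transpose_iff] at hz ⊢
    intro w hw
    refine hz w ?_
    rw [toEuclideanLin_mul_apply] at hw
    rw [← inner_self_eq_zero (𝕜 := ℝ), inner_toEuclideanLin_left, hw, inner_zero_right]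
  rw [Matrix.transpose_mul, Matrix.transpose_transpose] at h
  obtain ⟨w, rfl⟩ := h
  exact ⟨A.toEuclideanLin w, ⟨w, rfl⟩, (toEuclideanLin_mul_apply _ _ _).symm⟩

end Range

section Kernel

variable {m d q : ℕ}

theorem bigB_toEuclideanLin_eq_zero_iff (B : Matrix (Fin q) (Fin d) ℝ) (x : Stack m d) :
    (bigB m B).toEuclideanLin x = 0 ↔ ∀ i, B *ᵥ (fun j => x (i, j)) = 0 := by
  have h : ∀ i k, (bigB m B).toEuclideanLin x (i, k) = (B *ᵥ fun j => x (i, j)) k := by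
    intro i k
    simp [Matrix.toLpLin_apply, bigB, Matrix.mulVec, dotProduct, Fintype.sum_prod_type,
      Matrix.kroneckerMap_apply, Matrix.one_apply, ite_mul]
  constructor
  · intro hx i
    ext k
    rw [← h, hx]; rfl
  · intro hx
    ext ⟨i, k⟩
    rw [h, hx]; rfl

theorem bigW_toEuclideanLin_eq_zero_iff (W : Matrix (Fin m) (Fin m) ℝ) (x : Stack m d) :
    (bigW d W).toEuclideanLin x = 0 ↔ ∀ j, W *ᵥ (fun i => x (i, j)) = 0 := by
  have h : ∀ i k, (bigW d W).toEuclideanLin x (i, k) = (W *ᵥ fun l => x (l, k)) i := by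
    intro i k
    simp [Matrix.toLpLin_apply, bigW, Matrix.mulVec, dotProduct, Fintype.sum_prod_type,
      Matrix.kroneckerMap_apply, Matrix.one_apply, ite_mul]
  constructor
  · intro hx k
    ext i
    rw [← h, hx]; rfl
  · intro hx
    ext ⟨i, k⟩
    rw [h, hx]; rfl

theorem conMat_toEuclideanLin_eq_zero_iff (B : Matrix (Fin q) (Fin d) ℝ)
    (W : Matrix (Fin m) (Fin m) ℝ) {γ : ℝ} (hγ : γ ≠ 0) (x : Stack m d) :
    (conMat B W γ).toEuclideanLin x = 0 ↔
      (bigW d W).toEuclideanLin x = 0 ∧ (bigB m B).toEuclideanLin x = 0 := by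
  simp only [Matrix.toLpLin_apply, conMat, Matrix.fromRows_mulVec, Matrix.smul_mulVec,
    WithLp.toLp_eq_zero]
  constructor
  · intro h
    have h1 : γ • (bigW d W *ᵥ x.ofLp) = 0 := funext fun a => congrFun h (Sum.inr a)
    exact ⟨(smul_eq_zero.mp h1).resolve_left hγ, funext fun a => congrFun h (Sum.inl a)⟩
  · rintro ⟨h1, h2⟩
    rw [h1, h2]
    ext a
    cases a <;> simp

end Kernel

/-! ### The decentralized problem -/

section Block

variable {m q : ℕ}

theorem inner_eq_sum_block (x y : Stack m q) :
    inner ℝ x y = ∑ i, inner ℝ (block x i) (block y i) := by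
  simp [PiLp.inner_apply, block, Fintype.sum_prod_type]

theorem norm_sq_eq_sum_block (x : Stack m q) : ‖x‖ ^ 2 = ∑ i, ‖block x i‖ ^ 2 := by
  simp_rw [← real_inner_self_eq_norm_sq]
  exact inner_eq_sum_block x x

theorem block_sub (x y : Stack m q) (i : Fin m) : block (x - y) i = block x i - block y i := rfl

end Block

namespace Problem

variable {m d p : ℕ} {P : Problem m d p}

theorem Valid.quadraticBounds (hP : P.Valid) : QuadraticBounds P.μ P.L P.F P.gradF := by
  have hg : ∀ x i, block (P.gradF x) i = gradient (P.f i) (block x i) := fun _ _ => rfl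
  constructor
  all_goals
    intro x y
    simp only [Problem.F, inner_eq_sum_block, norm_sq_eq_sum_block, hg, block_sub,
      Finset.mul_sum, ← Finset.sum_add_distrib]
  · exact Finset.sum_le_sum fun i _ => (hP.objective i).lower _ _
  · exact Finset.sum_le_sum fun i _ => (hP.objective i).upper _ _

/-- The two quadratic bounds compare `μ` and `L` only along a nonzero vector; the nontrivial kernel
of `B` supplies one. -/
theorem Valid.mu_le_L (hP : P.Valid) : P.μ ≤ P.L := by
  obtain ⟨v, hv, -⟩ := hP.ker_B
  have hm : 0 < m := by have := hP.two_le; omega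
  have h1 := (hP.objective ⟨0, hm⟩).lower 0 (WithLp.toLp 2 v)
  have h2 := (hP.objective ⟨0, hm⟩).upper 0 (WithLp.toLp 2 v)
  rw [sub_zero] at h1 h2
  have hpos : 0 < ‖WithLp.toLp 2 v‖ ^ 2 := by
    have : WithLp.toLp 2 v ≠ 0 := by rwa [Ne, WithLp.toLp_eq_zero]
    positivity
  have h3 : P.μ * ‖WithLp.toLp 2 v‖ ^ 2 ≤ P.L * ‖WithLp.toLp 2 v‖ ^ 2 := by linarith
  exact le_of_mul_le_mul_right h3 hpos

theorem Valid.W_ne_zero (hP : P.Valid) : P.W ≠ 0 := by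
  intro h
  have h2 := hP.two_le
  have h1 := (hP.mixing.kernel (Pi.single ⟨0, by omega⟩ 1)).mp (by rw [h, Matrix.zero_mulVec])
    ⟨0, by omega⟩ ⟨1, by omega⟩
  rw [Pi.single_eq_same, Pi.single_eq_of_ne (by simp)] at h1
  exact one_ne_zero h1

theorem Valid.exists_mem_ker_W (hP : P.Valid) : ∃ v : Fin m → ℝ, v ≠ 0 ∧ P.W *ᵥ v = 0 := by
  refine ⟨1, ?_, (hP.mixing.kernel 1).mpr fun _ _ => rfl⟩
  intro h
  exact one_ne_zero (congrFun h ⟨0, by have := hP.two_le; omega⟩)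

theorem Valid.gram_ne_zero (hP : P.Valid) : P.Bᵀ * P.B ≠ 0 := by
  intro h
  rw [← Matrix.conjTranspose_eq_transpose_of_trivial, Matrix.conjTranspose_mul_self_eq_zero] at h
  exact hP.B_ne_zero h

theorem gram_mulVec_eq_zero_iff {κ ι : Type} [Fintype κ] [Fintype ι] (B : Matrix κ ι ℝ)
    (x : ι → ℝ) : (Bᵀ * B) *ᵥ x = 0 ↔ B *ᵥ x = 0 := by
  rw [← Matrix.conjTranspose_eq_transpose_of_trivial,
    Matrix.conjTranspose_mul_self_mulVec_eq_zero]

/-- The first-order optimality condition. -/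
theorem Valid.inner_gradF_eq_zero (hP : P.Valid) {xs w : Stack m d} (hxs : P.IsSolution xs)
    (hw : P.Feasible w) : inner ℝ w (P.gradF xs) = 0 := by
  have hL : 0 < P.L := hP.mu_pos.trans_le hP.mu_le_L
  have key : ∀ t : ℝ, 0 ≤ t * inner ℝ w (P.gradF xs) + P.L / 2 * (t ^ 2 * ‖w‖ ^ 2) := by
    intro t
    have hfeas : P.Feasible (xs + t • w) := by
      constructor
      · rw [map_add, map_smul, hxs.1.1, hw.1, smul_zero, add_zero]
      · rw [map_add, map_smul, hxs.1.2, hw.2, smul_zero, add_zero]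
    have h1 := hxs.2 _ hfeas
    have h2 := hP.quadraticBounds.upper xs (xs + t • w)
    rw [add_sub_cancel_left, real_inner_smul_right, norm_smul, mul_pow, Real.norm_eq_abs, sq_abs,
      real_inner_comm] at h2
    linarith
  set a := inner ℝ w (P.gradF xs)
  set b := P.L / 2 * ‖w‖ ^ 2
  have hb : 0 ≤ b := by positivity
  -- Near the minimizer of the quadratic `t a + t² b`; the `+ 1` avoids dividing by zero when `w =
  -- 0`.
  have h := key (-a / (b + 1))
  have h2 : -a / (b + 1) * a + P.L / 2 * ((-a / (b + 1)) ^ 2 * ‖w‖ ^ 2)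
      = -(a ^ 2 / (b + 1) ^ 2) := by
    have : P.L / 2 * ((-a / (b + 1)) ^ 2 * ‖w‖ ^ 2) = (-a / (b + 1)) ^ 2 * b := by ring
    rw [this]
    field_simp
    ring
  rw [h2] at h
  have h3 : a ^ 2 / (b + 1) ^ 2 = 0 := le_antisymm (by linarith) (by positivity)
  rw [div_eq_zero_iff] at h3
  rcases h3 with h3 | h3
  · exact pow_eq_zero_iff (two_ne_zero) |>.mp h3
  · have : 0 < (b + 1) ^ 2 := by positivity
    exact absurd h3 this.ne'

/-- An exponentially decaying distance to the solution gives the three accuracy estimates. -/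
theorem Valid.hasComplexity_of_exp_decay (hP : P.Valid) {xs x₀ p₀ : Stack m d}
    (hxs : P.A.toEuclideanLin xs = 0) {x : ℕ → Stack m d} {C κ κ₀ : ℝ} (hC : 2 ≤ C)
    (hκ₀ : 0 < κ₀) (hκ : κ₀ ≤ C * κ)
    (h : ∀ N : ℕ, ‖x N - xs‖ ≤
      Real.exp (-(N / κ₀)) * (2 * (P.L / P.μ) * P.initError xs x₀ p₀)) :
    P.HasComplexity C κ (C * (P.L / P.μ) * P.initError xs x₀ p₀) xs x := by
  have hμ := hP.mu_pos
  have hL : 0 < P.L := hP.mu_pos.trans_le hP.mu_le_L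
  have hr : 1 ≤ P.L / P.μ := (one_le_div hμ).mpr hP.mu_le_L
  have hE : 0 ≤ P.initError xs x₀ p₀ := by rw [initError]; positivity
  have hgE : ‖P.gradF xs‖ ≤ P.μ * P.initError xs x₀ p₀ := by
    have : P.μ * P.initError xs x₀ p₀ = P.μ * ‖x₀ - xs‖ + ‖p₀‖ + ‖P.gradF xs‖ := by
      rw [initError]; field_simp; ring
    rw [this]
    have : 0 ≤ P.μ * ‖x₀ - xs‖ := by positivity
    linarith [norm_nonneg p₀]
  set E := P.initError xs x₀ p₀
  set D := C * (P.L / P.μ) * E with hD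
  have hrE : 0 ≤ P.L / P.μ * E := by positivity
  have hVD : 2 * (P.L / P.μ) * E ≤ D := by rw [hD, mul_assoc, mul_assoc]; gcongr
  have hD0 : 0 ≤ D := by linarith
  have hx : ∀ N : ℕ, ‖x N - xs‖ ≤ Real.exp (-(N / κ₀)) * D := fun N =>
    (h N).trans (mul_le_mul_of_nonneg_left hVD (Real.exp_pos _).le)
  intro ε hε N
  have hN : (0 : ℝ) ≤ N := Nat.cast_nonneg N
  set e := Real.exp (-(N / κ₀)) with he
  have he0 : 0 < e := Real.exp_pos _
  have he1 : e ≤ 1 := by rw [he, Real.exp_le_one_iff, neg_nonpos]; positivity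
  have hX := hx N
  refine ⟨le_of_exp_decay hκ₀ hκ hD0 hε hN hX,
    le_of_exp_decay hκ₀ hκ (by positivity) hε hN ?_,
    le_of_exp_decay hκ₀ hκ (by positivity) hε hN ?_⟩
  · have h1 := hP.quadraticBounds.upper xs (x N)
    have h2 := hP.quadraticBounds.lower xs (x N)
    have h3 := abs_le.mp (abs_real_inner_le_norm (P.gradF xs) (x N - xs))
    have h4 : 0 ≤ P.μ / 2 * ‖x N - xs‖ ^ 2 := by positivity
    have h5 : 0 ≤ P.L / 2 * ‖x N - xs‖ ^ 2 := by positivity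
    -- The gradient need not vanish at a constrained minimizer, so the objective error has a linear
    -- term. `D` contains `‖∇F(x*)‖/μ`, which bounds that term by `L D²/2` times the decay factor.
    have h6 : ‖P.gradF xs‖ ≤ P.L / 2 * D := by
      have c1 : P.L * (2 * (P.L / P.μ) * E) ≤ P.L * D := mul_le_mul_of_nonneg_left hVD hL.le
      have c2 : P.μ * E ≤ P.L * (P.L / P.μ * E) := by
        have : E ≤ P.L / P.μ * E := le_mul_of_one_le_left hE hr
        exact mul_le_mul hP.mu_le_L this hE hL.le
      linarith
    have h7 : ‖P.gradF xs‖ * ‖x N - xs‖ ≤ P.L / 2 * D * (e * D) :=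
      mul_le_mul h6 hX (norm_nonneg _) (by positivity)
    have h8 : P.L / 2 * ‖x N - xs‖ ^ 2 ≤ P.L / 2 * (e * D ^ 2) := by
      have : ‖x N - xs‖ ^ 2 ≤ e * D ^ 2 := by
        calc ‖x N - xs‖ ^ 2 ≤ (e * D) ^ 2 := by gcongr
          _ = e * e * D ^ 2 := by ring
          _ ≤ e * 1 * D ^ 2 := by gcongr
          _ = e * D ^ 2 := by ring
      gcongr
    have h9 : P.L / 2 * D * (e * D) + P.L / 2 * (e * D ^ 2) = e * (P.L * D ^ 2) := by ring
    rw [abs_le]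
    constructor <;> linarith [h3.1, h3.2]
  · have h1 := norm_toEuclideanLin_sq_le P.A (x N - xs)
    rw [map_sub, hxs, sub_zero] at h1
    have h2 : ‖P.A.toEuclideanLin (x N)‖ ≤ √(lamMax (P.Aᵀ * P.A)) * ‖x N - xs‖ := by
      rw [← Real.sqrt_sq (norm_nonneg (P.A.toEuclideanLin (x N))),
        ← Real.sqrt_sq (norm_nonneg (x N - xs)), ← Real.sqrt_mul' _ (sq_nonneg _)]
      exact Real.sqrt_le_sqrt h1
    calc _ ≤ √(lamMax (P.Aᵀ * P.A)) * (e * D) := h2.trans (by gcongr)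
      _ = _ := by ring

/-- Convergence of APDG for any constraint matrix with the kernel of the constraints. -/
theorem Valid.hasComplexity_apdg (hP : P.Valid) {xs : Stack m d} (hxs : P.IsSolution xs)
    (hAxs : P.A.toEuclideanLin xs = 0) {κ : Type} [Fintype κ] [DecidableEq κ]
    {A : Matrix κ (Fin m × Fin d) ℝ} (hker : ∀ w, A.toEuclideanLin w = 0 ↔ P.Feasible w)
    (hA0 : Aᵀ * A ≠ 0) {C K : ℝ} (hC : 2 ≤ C)
    (hK : 32 * rateNum P.μ P.L (lamMinPos (Aᵀ * A)) (lamMax (Aᵀ * A)) ≤ C * K)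
    (x₀ : Stack m d) {y₀ : EuclideanSpace ℝ κ} (hy₀ : y₀ ∈ A.toEuclideanLin.range) :
    P.HasComplexity C K (C * (P.L / P.μ) * P.initError xs x₀ (Aᵀ.toEuclideanLin y₀)) xs
      (fun N => (apdg A P.gradF (P.params apdgRule (Aᵀ * A)) x₀ y₀ N).x) := by
  have hpsd := posSemidef_transpose_mul_self A
  have hgr : -P.gradF xs ∈ Aᵀ.toEuclideanLin.range := by
    rw [mem_range_transpose_iff]
    intro w hw
    rw [inner_neg_right, hP.inner_gradF_eq_zero hxs ((hker w).mp hw), neg_zero]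
  obtain ⟨ys, hys, hsad⟩ := exists_mem_range_of_mem_range_transpose A hgr
  have hκ := one_le_rateNum (μ := P.μ) (L := P.L) (lamMinPos_pos hpsd hA0)
    (lamMinPos_le_lamMax hpsd hA0)
  refine hP.hasComplexity_of_exp_decay hAxs hC (by linarith) hK fun N => ?_
  exact norm_apdg_sub_le hA0 hP.mu_pos hP.mu_le_L hP.quadraticBounds ((hker xs).mpr hxs.1) hys
    hsad x₀ hy₀ N

end Problem

end DecOpt

theorem mainTheorem2 :
    ∃ (C : ℝ) (par : ℝ → ℝ → ℝ → ℝ → APDGParams), 0 < C ∧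
      (∀ μ L l u : ℝ, 0 < μ → μ ≤ L → 0 < l → l ≤ u → (par μ L l u).Valid) ∧
      ∀ (m d p : ℕ) (P : Problem m d p), P.Valid →
      ∀ xs : Stack m d, P.IsSolution xs →
        -- the optimal scaling `γ` and the condition number
        (0 < gammaOpt (P.Bᵀ * P.B) P.W ∧
          IsMinOn (fun γ : ℝ => condNum ((conMat P.B P.W γ)ᵀ * conMat P.B P.W γ)) (Set.Ioi 0)
            (gammaOpt (P.Bᵀ * P.B) P.W) ∧
          condNum (P.Aᵀ * P.A) = condNum P.W ^ 2 + condNum (P.Bᵀ * P.B)) ∧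
        -- APDG applied directly
        (∀ (x₀ : Stack m d) (y₀ : Mult m p d),
          x₀ ∈ P.Aᵀ.toEuclideanLin.range → y₀ ∈ P.A.toEuclideanLin.range →
          (∀ N, (P.directProg par x₀ y₀ N).out P =
            apdg P.A P.gradF (P.params par (P.Aᵀ * P.A)) x₀ y₀ N) ∧
          (∀ N, (P.directProg par x₀ y₀ N).gradCalls P = N ∧
            ((P.directProg par x₀ y₀ N).commRounds P : ℝ) ≤ C * N) ∧
          P.HasComplexity C
            (max (√(condNum P.W ^ 2 + condNum (P.Bᵀ * P.B)) * √(P.L / P.μ))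
              (condNum P.W ^ 2 + condNum (P.Bᵀ * P.B)))
            (C * (P.L / P.μ) * P.initError xs x₀ (P.Aᵀ.toEuclideanLin y₀)) xs
            (fun N => ((P.directProg par x₀ y₀ N).out P).x)) ∧
        -- the Chebyshev polynomials
        (((cheb P.W).natDegree : ℝ) ≤ C * √(condNum P.W) ∧
          ((cheb (P.Bᵀ * P.B)).natDegree : ℝ) ≤ C * √(condNum (P.Bᵀ * P.B)) ∧
          condNum P.chebW ≤ C ∧ condNum P.chebBTB ≤ C) ∧
        -- APDG with Chebyshev acceleration
        (∀ x₀ p₀ : Stack m d,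
          x₀ ∈ P.Aᵀ.toEuclideanLin.range → p₀ ∈ P.Aᵀ.toEuclideanLin.range →
          -- it is APDG for the matrix `[I ⊗ B'; γ P_K(W) ⊗ I]` with `B'ᵀB' = P_M(BᵀB)`
          (∃ B' : Matrix (Fin d) (Fin d) ℝ, B'ᵀ * B' = P.chebBTB ∧
            x₀ ∈ (conMat B' P.chebW P.gammaCheb)ᵀ.toEuclideanLin.range ∧
            ∃ y₀ ∈ (conMat B' P.chebW P.gammaCheb).toEuclideanLin.range,
              (conMat B' P.chebW P.gammaCheb)ᵀ.toEuclideanLin y₀ = p₀ ∧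
              ∀ N, ((P.chebProg par x₀ p₀ N).out P).x =
                (apdg (conMat B' P.chebW P.gammaCheb) P.gradF (P.params par P.gramCheb)
                  x₀ y₀ N).x) ∧
          (∀ N, (P.chebProg par x₀ p₀ N).gradCalls P = N ∧
            ((P.chebProg par x₀ p₀ N).commRounds P : ℝ) ≤ C * (N * √(condNum P.W)) ∧
            ((P.chebProg par x₀ p₀ N).multsB P : ℝ) ≤ C * (N * √(condNum (P.Bᵀ * P.B)))) ∧
          P.HasComplexity C (√(P.L / P.μ))
            (C * (P.L / P.μ) * P.initError xs x₀ p₀) xs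
            (fun N => ((P.chebProg par x₀ p₀ N).out P).x)) := by
  -- `640 = 32 · 20`: the decay constant of `norm_apdg_sub_le` times the bound `20` on the condition
  -- number after acceleration.
  refine ⟨640, apdgRule, by norm_num, fun μ L l u hμ hL hl hu => apdgRule_valid hμ hL hl hu, ?_⟩
  intro m d p P hP xs hxs
  have hW := hP.mixing.posSemidef
  have hW0 := hP.W_ne_zero
  have hQ := posSemidef_transpose_mul_self P.B
  have hQ0 := hP.gram_ne_zero
  obtain ⟨v, hv, hWv⟩ := hP.exists_mem_ker_W
  obtain ⟨w, hw, hBw⟩ := hP.ker_B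
  have hQw : (P.Bᵀ * P.B) *ᵥ w = 0 := (Problem.gram_mulVec_eq_zero_iff _ _).mpr hBw
  have hWz := zero_mem_spectrum_of_mulVec_eq_zero hW.1 hv hWv
  have hQz := zero_mem_spectrum_of_mulVec_eq_zero hQ.1 hw hQw
  have hγ := gammaOpt_pos hQ hQ0 hW hW0
  have hr : 1 ≤ P.L / P.μ := (one_le_div hP.mu_pos).mpr hP.mu_le_L
  have hgram : P.Aᵀ * P.A = bigB m (P.Bᵀ * P.B) +
      gammaOpt (P.Bᵀ * P.B) P.W ^ 2 • bigW d (P.W * P.W) := conMat_gram P.B hW.1 _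
  have hcond : condNum (P.Aᵀ * P.A) = condNum P.W ^ 2 + condNum (P.Bᵀ * P.B) := by
    rw [hgram, condNum_gram_gammaOpt hQ hW hQ0 hW0 hQz hWz]
  have hkerA : ∀ z, P.A.toEuclideanLin z = 0 ↔ P.Feasible z := fun z =>
    conMat_toEuclideanLin_eq_zero_iff P.B P.W hγ.ne' z
  have hAxs : P.A.toEuclideanLin xs = 0 := (hkerA xs).mpr hxs.1
  have hA0 : P.Aᵀ * P.A ≠ 0 := by rw [hgram]; exact gram_ne_zero hQ hQ0 hW hW0 _
  have hcW : P.chebW.PosSemidef := aeval_cheb_posSemidef hW hW0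
  have hcW0 : P.chebW ≠ 0 := aeval_cheb_ne_zero hW hW0
  have hcQ : P.chebBTB.PosSemidef := aeval_cheb_posSemidef hQ hQ0
  have hcQ0 : P.chebBTB ≠ 0 := aeval_cheb_ne_zero hQ hQ0
  have hχW : condNum P.chebW ≤ 4 := condNum_aeval_cheb_le hW hW0
  have hχQ : condNum P.chebBTB ≤ 4 := condNum_aeval_cheb_le hQ hQ0
  have hdW := natDegree_cheb_le hW hW0
  have hdQ := natDegree_cheb_le hQ hQ0
  refine ⟨⟨hγ, ?_, hcond⟩, ?_, ⟨?_, ?_, by linarith, by linarith⟩, ?_⟩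
  · intro γ hγ'
    change condNum (P.Aᵀ * P.A) ≤ condNum ((conMat P.B P.W γ)ᵀ * conMat P.B P.W γ)
    rw [hcond, conMat_gram P.B hW.1]
    exact le_condNum_gram hQ hW hQ0 hW0 hQz hWz hγ'
  · intro x₀ y₀ _ hy₀
    have hout : ∀ N, (P.directProg apdgRule x₀ y₀ N).out P =
        apdg P.A P.gradF (P.params apdgRule (P.Aᵀ * P.A)) x₀ y₀ N := fun N =>
      Prog.out_apdg P hW.1 _ _ x₀ y₀ N
    refine ⟨hout, fun N => ⟨Prog.gradCalls_apdg P _ _ x₀ y₀ N, ?_⟩, ?_⟩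
    · rw [Problem.directProg, Prog.commRounds_apdg]
      push_cast
      have : (0 : ℝ) ≤ N := Nat.cast_nonneg N
      linarith
    · simp only [hout]
      refine hP.hasComplexity_apdg hxs hAxs hkerA hA0 (by norm_num) ?_ x₀ hy₀
      have hκ := one_le_rateNum (μ := P.μ) (L := P.L)
        (lamMinPos_pos (posSemidef_transpose_mul_self P.A) hA0)
        (lamMinPos_le_lamMax (posSemidef_transpose_mul_self P.A) hA0)
      have : rateNum P.μ P.L (lamMinPos (P.Aᵀ * P.A)) (lamMax (P.Aᵀ * P.A)) =
          max (√(condNum P.W ^ 2 + condNum (P.Bᵀ * P.B)) * √(P.L / P.μ))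
            (condNum P.W ^ 2 + condNum (P.Bᵀ * P.B)) := by
        rw [← hcond]; rfl
      rw [← this]
      linarith
  · linarith [Real.sqrt_nonneg (condNum P.W)]
  · linarith [Real.sqrt_nonneg (condNum (P.Bᵀ * P.B))]
  · intro x₀ p₀ hx₀ hp₀
    obtain ⟨B', hB'⟩ := exists_transpose_mul_self_eq hcQ
    have hγc : 0 < P.gammaCheb := gammaOpt_pos hcQ hcQ0 hcW hcW0
    have hgramc : (conMat B' P.chebW P.gammaCheb)ᵀ * conMat B' P.chebW P.gammaCheb =
        P.gramCheb := by
      rw [conMat_gram B' hcW.1, hB']; rfl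
    have hkerB : ∀ z, B' *ᵥ z = 0 ↔ P.B *ᵥ z = 0 := fun z => by
      rw [← Problem.gram_mulVec_eq_zero_iff B', hB', Problem.chebBTB,
        aeval_cheb_mulVec_eq_zero_iff hQ hQ0, Problem.gram_mulVec_eq_zero_iff]
    have hkerW : ∀ z, P.chebW *ᵥ z = 0 ↔ P.W *ᵥ z = 0 := aeval_cheb_mulVec_eq_zero_iff hW hW0
    have hkerc : ∀ z, (conMat B' P.chebW P.gammaCheb).toEuclideanLin z = 0 ↔ P.Feasible z := by
      intro z
      rw [conMat_toEuclideanLin_eq_zero_iff _ _ hγc.ne', Problem.Feasible,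
        bigW_toEuclideanLin_eq_zero_iff, bigW_toEuclideanLin_eq_zero_iff,
        bigB_toEuclideanLin_eq_zero_iff, bigB_toEuclideanLin_eq_zero_iff]
      simp only [hkerB, hkerW]
    -- Each range is the orthogonal complement of a kernel, and the two kernels are the same
    -- feasible subspace.
    have hrange : ∀ z, z ∈ P.Aᵀ.toEuclideanLin.range →
        z ∈ (conMat B' P.chebW P.gammaCheb)ᵀ.toEuclideanLin.range := by
      intro z hz
      rw [mem_range_transpose_iff] at hz ⊢
      exact fun t ht => hz t ((hkerA t).mpr ((hkerc t).mp ht))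
    obtain ⟨y₀, hy₀, rfl⟩ := exists_mem_range_of_mem_range_transpose _ (hrange p₀ hp₀)
    have hout : ∀ N, ((P.chebProg apdgRule x₀
        ((conMat B' P.chebW P.gammaCheb)ᵀ.toEuclideanLin y₀) N).out P).x =
        (apdg (conMat B' P.chebW P.gammaCheb) P.gradF (P.params apdgRule P.gramCheb)
          x₀ y₀ N).x := by
      intro N
      rw [Problem.chebProg, Prog.out_acc P _ _ _ _ hgramc]
      rfl
    refine ⟨⟨B', hB', hrange x₀ hx₀, y₀, hy₀, rfl, hout⟩,
      fun N => ⟨Prog.gradCalls_acc P _ _ _ _ _ _ N, ?_, ?_⟩, ?_⟩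
    · rw [Problem.chebProg, Prog.commRounds_acc]
      push_cast
      have h1 : (N : ℝ) * (cheb P.W).natDegree ≤ N * √(condNum P.W) := by gcongr
      have h2 : 0 ≤ (N : ℝ) * √(condNum P.W) := by positivity
      linarith
    · rw [Problem.chebProg, Prog.multsB_acc]
      push_cast
      have h1 : (N : ℝ) * (cheb (P.Bᵀ * P.B)).natDegree ≤ N * √(condNum (P.Bᵀ * P.B)) := by gcongr
      have h2 : 0 ≤ (N : ℝ) * √(condNum (P.Bᵀ * P.B)) := by positivity
      linarith
    · simp only [hout]
      rw [← hgramc]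
      have hG0 : P.gramCheb ≠ 0 := gram_ne_zero hcQ hcQ0 hcW hcW0 _
      refine hP.hasComplexity_apdg hxs hAxs hkerc (by rw [hgramc]; exact hG0) (by norm_num) ?_
        x₀ hy₀
      rw [hgramc]
      have hzW := zero_mem_spectrum_of_mulVec_eq_zero hcW.1 hv ((hkerW v).mpr hWv)
      have hzQ := zero_mem_spectrum_of_mulVec_eq_zero hcQ.1 hw
        ((aeval_cheb_mulVec_eq_zero_iff hQ hQ0 w).mpr hQw)
      have hχ : condNum P.gramCheb = condNum P.chebW ^ 2 + condNum P.chebBTB :=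
        condNum_gram_gammaOpt hcQ hcW hcQ0 hcW0 hzQ hzW
      have h1 := one_le_condNum hcW hcW0
      have hχ20 : condNum P.gramCheb ≤ 20 := by rw [hχ]; nlinarith
      have hsr : 1 ≤ √(P.L / P.μ) := Real.one_le_sqrt.mpr hr
      have hsχ : √(condNum P.gramCheb) ≤ 20 :=
        Real.sqrt_le_iff.mpr ⟨by norm_num, by linarith⟩
      have hmax : rateNum P.μ P.L (lamMinPos P.gramCheb) (lamMax P.gramCheb) ≤
          20 * √(P.L / P.μ) := by
        refine max_le ?_ ?_
        · exact mul_le_mul_of_nonneg_right hsχ (by linarith)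
        · exact hχ20.trans (by linarith)
      linarith
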